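/- **Setting.** Let $d\ge 0$, $T>0$. Let $a:\mathbb{R}^d\to\mathbb{R}^d$ be $C^1$ with bounded derivative and let $\nu\in C_b^1(\mathbb{R}^d;\mathbb{R})$ ($C^1$, bounded, with bounded derivative). For a finite (nonnegative) Borel measure $f_0$ on $\mathbb{R}^d$, let $f$ be the weak solution on $[0,T]$ of $$\partial_t f+\nabla\cdot(a f)=0,\qquad f(0)=f_0,$$ that is, a narrowly continuous curve of finite measures with $f(0)=f_0$ and $\int\psi\,df(t)=\int\psi\,df_0+\int_0^t\!\int a\cdot\nabla\psi\,df(s)\,ds$ for all $\psi\in C_c^1(\mathbb{R}^d)$, $t\in[0,T]$, and put $\mathcal J[a;f_0]=\int\nu\,df(T)$. For $X_0\in\mathbb{R}^d$ let $\dot X=a(X)$ on $[0,T]$, $X(0)=X_0$, and put $\mathsf J[a;X_0]=\nu(X(T))$. For $X_{1,0},\dots,X_{N,0}\in\mathbb{R}^d$ put $\mathsf J_N[a;X_{1,0},\dots,X_{N,0}]=\frac1N\sum_{i=1}^N\mathsf J[a;X_{i,0}]$. The first variation $\frac{\delta F}{\delta a}$ of a functional $F$ of the velocity field is the generalized vector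 field, i.e. the linear functional on $C_b^1(\mathbb{R}^d;\mathbb{R}^d)$, bounded in the $C^1_b$ norm, such that $\frac{d}{d\varepsilon}\big|_{\varepsilon=0}F[a+\varepsilon\varphi]=\big\langle\frac{\delta F}{\delta a},\varphi\big\rangle$ for all $\varphi\in C_b^1(\mathbb{R}^d;\mathbb{R}^d)$. **Theorem.** Both forward problems have a solution, unique on $[0,T]$, and the first variations of $\mathcal J[\cdot\,;f_0]$, $\mathsf J[\cdot\,;X_0]$ and (for every $N\ge1$) $\mathsf J_N$ at $a$ exist for all initial data. Moreover: (a) If $f_0=\delta_{X_0}$, then $\frac{\delta\mathcal J}{\delta a}(\cdot\,;f_0)=\frac{\delta\mathsf J}{\delta a}(\cdot\,;X_0)$. (b) For every finite measure $f_0$, $\frac{\delta\mathcal J}{\delta a}(\cdot\,;f_0)=\int\frac{\delta\mathsf J}{\delta a}(\cdot\,;y)\,f_0(dy)$ weakly: for every $\varphi\in C_b^1(\mathbb{R}^d;\mathbb{R}^d)$ the function $y\mapsto\langle\frac{\delta\mathsf J}{\delta a}(\cdot\,;y),\varphi\rangle$ is $f_0$-integrable, and its integral is $\langle\frac{\delta\mathcal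 J}{\delta a}(\cdot\,;f_0),\varphi\rangle$. Consequently the particle gradient is unbiased for every finite $N\ge1$: if $X_{1,0},\dots,X_{N,0}$ are random points, each with law $f_0$ (independent or not), then for every $\varphi\in C_b^1(\mathbb{R}^d;\mathbb{R}^d)$ the random variable $\langle\frac{\delta\mathsf J_N}{\delta a}(\cdot\,;X_{1,0},\dots,X_{N,0}),\varphi\rangle$ is integrable with expectation $\langle\frac{\delta\mathcal J}{\delta a}(\cdot\,;f_0),\varphi\rangle$. (c) The PDE adjoint problem $\partial_t g+a\cdot\nabla g=0$ on $[0,T]\times\mathbb{R}^d$, $g(T,\cdot)=\nu$, has a $C^1$ solution; for every characteristic $X$ the particle adjoint problem $\dot Y+(Da(X))^{\top}Y=0$ on $[0,T]$, $Y(T)=\nabla\nu(X(T))$, has a solution. For all such solutions, $\nabla g(t,X(t))=Y(t)$ for $t\in[0,T]$, and for all $\varphi\in C_b^1(\mathbb{R}^d;\mathbb{R}^d)$ $$\Big\langle\frac{\delta\mathcal J}{\delta a}(\cdot\,;f_0),\varphi\Big\rangle=\int_0^T\!\!\int\nabla g(t,x)\cdot\varphi(x)\,f(t,dx)\,dt,\qquad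 \Big\langle\frac{\delta\mathsf J}{\delta a}(\cdot\,;X_0),\varphi\Big\rangle=\int_0^T Y(t)\cdot\varphi(X(t))\,dt.$$ -/

import Mathlib

open MeasureTheory

namespace TransportVariation

/-- The state space `ℝ^d` with its Euclidean norm and inner product. -/
abbrev Vec (d : ℕ) : Type := EuclideanSpace ℝ (Fin d)

variable {d : ℕ}

/-- `h` is `C¹` with bounded derivative. -/
def IsC1BddDeriv {F : Type*} [NormedAddCommGroup F] [NormedSpace ℝ F] (h : Vec d → F) : Prop :=
  ContDiff ℝ 1 h ∧ ∃ K : ℝ, ∀ x, ‖fderiv ℝ h x‖ ≤ K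

/-- `h` belongs to `C_b¹`: it is `C¹`, bounded, and its derivative is bounded. -/
def IsCb1 {F : Type*} [NormedAddCommGroup F] [NormedSpace ℝ F] (h : Vec d → F) : Prop :=
  IsC1BddDeriv h ∧ ∃ M : ℝ, ∀ x, ‖h x‖ ≤ M

/-- The vector space `C_b¹(ℝ^d; ℝ^d)` of perturbations of the velocity field. -/
def testFields (d : ℕ) : Submodule ℝ (Vec d → Vec d) where
  carrier := {φ | IsCb1 φ}
  zero_mem' := by
    refine ⟨⟨contDiff_const, 0, fun x => ?_⟩, 0, fun x => by simp⟩
    change ‖fderiv ℝ (fun _ : Vec d => (0 : Vec d)) x‖ ≤ 0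
    simp
  add_mem' := by
    rintro φ ψ ⟨⟨hφ, K, hK⟩, M, hM⟩ ⟨⟨hψ, K', hK'⟩, M', hM'⟩
    refine ⟨⟨hφ.add hψ, K + K', fun x => ?_⟩, M + M', fun x => ?_⟩
    · rw [fderiv_add (hφ.differentiable one_ne_zero x) (hψ.differentiable one_ne_zero x)]
      exact (norm_add_le _ _).trans (add_le_add (hK x) (hK' x))
    · exact (norm_add_le _ _).trans (add_le_add (hM x) (hM' x))
  smul_mem' := by
    rintro c φ ⟨⟨hφ, K, hK⟩, M, hM⟩
    refine ⟨⟨hφ.const_smul c, |c| * K, fun x => ?_⟩, |c| * M, fun x => ?_⟩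
    · rw [fderiv_const_smul (hφ.differentiable one_ne_zero x), norm_smul]
      exact mul_le_mul_of_nonneg_left (hK x) (abs_nonneg c)
    · rw [Pi.smul_apply, norm_smul]
      exact mul_le_mul_of_nonneg_left (hM x) (abs_nonneg c)

/-! ### First variations -/

/-- `L` is the first variation at `a` of the functional `F` of the velocity field: the bounded
linear functional `L = ⟨δF/δa, ·⟩` on `C_b¹(ℝ^d; ℝ^d)` such that
`d/dε F[a + ε φ] = ⟨δF/δa, φ⟩` at `ε = 0` for every perturbation `φ`. -/
def HasFirstVariation (F : (Vec d → Vec d) → ℝ) (a : Vec d → Vec d)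
    (L : testFields d →ₗ[ℝ] ℝ) : Prop :=
  (∀ φ : testFields d,
    HasDerivAt (fun ε : ℝ => F (a + ε • (φ : Vec d → Vec d))) (L φ) 0) ∧
  ∃ C : ℝ, ∀ (φ : testFields d) (M : ℝ),
    (∀ x, ‖(φ : Vec d → Vec d) x‖ ≤ M ∧ ‖fderiv ℝ (φ : Vec d → Vec d) x‖ ≤ M) →
      |L φ| ≤ C * M

/-- The first variation of `F` at `a` exists. -/
def FirstVariationExists (F : (Vec d → Vec d) → ℝ) (a : Vec d → Vec d) : Prop :=
  ∃ L : testFields d →ₗ[ℝ] ℝ, HasFirstVariation F a L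

open Classical in
/-- The first variation `δF/δa`, as a linear functional on perturbations
(and `0` if it does not exist). -/
noncomputable def firstVariation (F : (Vec d → Vec d) → ℝ) (a : Vec d → Vec d) :
    testFields d →ₗ[ℝ] ℝ :=
  if h : FirstVariationExists F a then h.choose else 0

theorem HasFirstVariation.firstVariation_eq {F : (Vec d → Vec d) → ℝ} {a : Vec d → Vec d}
    {L : testFields d →ₗ[ℝ] ℝ} (h : HasFirstVariation F a L) : firstVariation F a = L := by
  have hex : FirstVariationExists F a := ⟨L, h⟩
  rw [firstVariation, dif_pos hex]
  ext φ
  exact (hex.choose_spec.1 φ).unique (h.1 φ)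

/-! ### The particle formulation -/

/-- `X` solves `Ẋ(t) = a(X(t))` on `[0, T]` with `X(0) = X₀`. -/
def IsCharacteristic (T : ℝ) (a : Vec d → Vec d) (X₀ : Vec d) (X : ℝ → Vec d) : Prop :=
  X 0 = X₀ ∧ ∀ t ∈ Set.Icc 0 T, HasDerivWithinAt X (a (X t)) (Set.Icc 0 T) t

/-- The solution of the characteristic equation (unique on `[0, T]` when `a` is Lipschitz). -/
noncomputable def characteristic (T : ℝ) (a : Vec d → Vec d) (X₀ : Vec d) : ℝ → Vec d :=
  Classical.epsilon (IsCharacteristic T a X₀)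

/-- The particle objective `J[a; X₀] = ν(X(T))`. -/
noncomputable def particleObjective (T : ℝ) (ν : Vec d → ℝ) (X₀ : Vec d)
    (a : Vec d → Vec d) : ℝ :=
  ν (characteristic T a X₀ T)

/-- The objective `(1/N) ∑ᵢ ν(Xᵢ(T))` of `N` non-interacting particles. -/
noncomputable def nParticleObjective (T : ℝ) (ν : Vec d → ℝ) {N : ℕ} (X₀ : Fin N → Vec d)
    (a : Vec d → Vec d) : ℝ :=
  (N : ℝ)⁻¹ * ∑ i, particleObjective T ν (X₀ i) a

/-- `Y` solves the particle adjoint equation `Ẏ + ∇a(X) Y = 0` on `[0, T]`,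
`Y(T) = ∇ν(X(T))`, where `(∇a)ⱼᵢ = ∂ⱼ aᵢ`, i.e. `∇a` is the transpose of the Jacobian. -/
def IsParticleAdjoint (T : ℝ) (a : Vec d → Vec d) (ν : Vec d → ℝ) (X Y : ℝ → Vec d) : Prop :=
  (∀ t ∈ Set.Icc 0 T, HasDerivWithinAt Y
    (-(ContinuousLinearMap.adjoint (fderiv ℝ a (X t))) (Y t)) (Set.Icc 0 T) t) ∧
  Y T = gradient ν (X T)

/-! ### The PDE formulation -/

/-- `f` is a weak, measure-valued solution of `∂ₜ f + ∇·(a f) = 0` on `[0, T]`, `f(0) = f₀`: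
a narrowly continuous curve of finite measures which satisfies, for every `ψ ∈ C_c¹(ℝ^d)`,
`∫ ψ df(t) = ∫ ψ df₀ + ∫₀ᵗ ∫ a · ∇ψ df(s) ds`. -/
def IsTransportSolution (T : ℝ) (a : Vec d → Vec d) (f₀ : FiniteMeasure (Vec d))
    (f : ℝ → FiniteMeasure (Vec d)) : Prop :=
  f 0 = f₀ ∧ ContinuousOn f (Set.Icc 0 T) ∧
  ∀ ψ : Vec d → ℝ, ContDiff ℝ 1 ψ → HasCompactSupport ψ → ∀ t ∈ Set.Icc 0 T,
    ∫ x, ψ x ∂(f t : Measure (Vec d)) =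
      ∫ x, ψ x ∂(f₀ : Measure (Vec d)) +
        ∫ s in (0 : ℝ)..t, ∫ x, fderiv ℝ ψ x (a x) ∂(f s : Measure (Vec d))

/-- The solution of the transport equation with velocity field `a` and initial datum `f₀`. -/
noncomputable def transportSolution (T : ℝ) (a : Vec d → Vec d) (f₀ : FiniteMeasure (Vec d)) :
    ℝ → FiniteMeasure (Vec d) :=
  Classical.epsilon (IsTransportSolution T a f₀)

/-- The PDE objective `J[a; f₀] = ∫ ν df(T)`. -/
noncomputable def pdeObjective (T : ℝ) (ν : Vec d → ℝ) (f₀ : FiniteMeasure (Vec d))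
    (a : Vec d → Vec d) : ℝ :=
  ∫ x, ν x ∂(transportSolution T a f₀ T : Measure (Vec d))

/-- The Dirac mass `δ_{X₀}` as a finite measure. -/
noncomputable def diracMass (X₀ : Vec d) : FiniteMeasure (Vec d) :=
  ⟨Measure.dirac X₀, inferInstance⟩

/-- `g` is a `C¹` solution of the PDE adjoint equation `∂ₜ g + a · ∇g = 0` on
`[0, T] × ℝ^d`, `g(T, ·) = ν`. -/
def IsPDEAdjoint (T : ℝ) (a : Vec d → Vec d) (ν : Vec d → ℝ) (g : ℝ → Vec d → ℝ) : Prop :=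
  ContDiffOn ℝ 1 (fun p : ℝ × Vec d => g p.1 p.2) (Set.Icc 0 T ×ˢ Set.univ) ∧
  (∀ t ∈ Set.Icc 0 T, ∀ x : Vec d,
    HasDerivWithinAt (fun s => g s x) (-(fderiv ℝ (g t) x (a x))) (Set.Icc 0 T) t) ∧
  ∀ x, g T x = ν x

end TransportVariation

open TransportVariation

/-! Everything is written through the global flow `Φ` of `a`. Characteristics are `Φ_t X₀`; the
transport solution is the push-forward of `f₀` by `Φ_t`; the adjoint state is `g(t,x) = ν(Φ_{T-t}
x)`, whose spatial derivative is `sensitivity`. The flow is `C¹` by linearisation and Grönwall, so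
`g` is a classical solution of the adjoint equation.

The heart is an exact identity (`terminal_value_flow_add_smul`). Let `Φ^ε` be the flow of `a + εφ`.
Since `∂ₜg + a·∇g = 0`, the time derivative of `g(t, Φ^ε_t y)` is `ε ∇g·φ`. Integrating over `[0,T]`
gives `ν(Φ^ε_T y) = ν(Φ_T y) + ε ∫ ∇g(t, Φ^ε_t y)·φ(Φ^ε_t y) dt`. Hence only continuity of the last
integral at `ε = 0` is needed, and the flow is never differentiated in `ε`. Integration over `f₀`
and dominated convergence give the first variation as the `f₀`-integral of `integratedSensitivity`.
The particle case is `f₀ = δ_y`, which yields (a), (b) and, by linearity of the expectation,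
unbiasedness.

For (c), Fubini turns the `f₀`-integral into one against `f(t)`, while duality with the linearised
flow gives `Y(t) = ∇g(t, X(t))`. Uniqueness for both PDEs extends these formulas to arbitrary
solutions: `g` is constant along characteristics, and the pull-back of `f(t)` by the flow is
constant in time (`IsTransportSolution.eq_map_flow`). -/

namespace TransportVariation

open Set Filter Topology NNReal

/-! ### Global existence and Grönwall bounds for Lipschitz differential equations -/

section GlobalODE

variable {E : Type*} [NormedAddCommGroup E] [NormedSpace ℝ E]

/-- Integration gains a factor `1 / c` against the weight `exp (c|t|)`; this gain makes the Picard
map a contraction on the whole line. -/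
theorem norm_integral_le_of_norm_le_exp_abs {c C : ℝ} (hc : 0 < c) (hC : 0 ≤ C) {g : ℝ → E}
    (hg : ∀ s, ‖g s‖ ≤ C * Real.exp (c * |s|)) (t : ℝ) :
    ‖∫ s in (0 : ℝ)..t, g s‖ ≤ C / c * Real.exp (c * |t|) := by
  have key : ∀ (h : ℝ → E), (∀ s, ‖h s‖ ≤ C * Real.exp (c * |s|)) → ∀ t, 0 ≤ t →
      ‖∫ s in (0 : ℝ)..t, h s‖ ≤ C / c * Real.exp (c * t) := by
    intro h hh t ht
    have hint : ∫ s in (0 : ℝ)..t, C * Real.exp (c * s) =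
        C / c * Real.exp (c * t) - C / c := by
      have hd : ∀ s ∈ uIcc 0 t,
          HasDerivAt (fun s => C / c * Real.exp (c * s)) (C * Real.exp (c * s)) s := by
        intro s _
        have h1 : HasDerivAt (fun s => c * s) c s := by simpa using (hasDerivAt_id s).const_mul c
        exact (h1.exp.const_mul (C / c)).congr_deriv (by field_simp)
      rw [intervalIntegral.integral_eq_sub_of_hasDerivAt hd
        (by apply Continuous.intervalIntegrable; fun_prop)]
      simp
    have h2 : ‖∫ s in (0 : ℝ)..t, h s‖ ≤ ∫ s in (0 : ℝ)..t, C * Real.exp (c * s) := by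
      apply intervalIntegral.norm_integral_le_of_norm_le ht
      · refine Eventually.of_forall fun s hs => ?_
        simpa [abs_of_pos hs.1] using hh s
      · apply Continuous.intervalIntegrable; fun_prop
    have : 0 ≤ C / c := by positivity
    linarith
  rcases le_total 0 t with ht | ht
  · simpa [abs_of_nonneg ht] using key g hg t ht
  · have h1 := key (fun s => g (-s)) (fun s => by simpa using hg (-s)) (-t) (by linarith)
    have h2 : ∫ s in (0 : ℝ)..-t, g (-s) = -∫ s in (0 : ℝ)..t, g s := by
      rw [intervalIntegral.integral_comp_neg, neg_neg, neg_zero, intervalIntegral.integral_symm]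
    rw [h2, norm_neg] at h1
    simpa [abs_of_nonpos ht] using h1

/-- Global existence for a differential equation with globally Lipschitz right-hand side. -/
theorem exists_forall_hasDerivAt_of_lipschitzWith [CompleteSpace E] {f : ℝ → E → E} {K : ℝ≥0}
    {M : ℝ} (hf : Continuous (Function.uncurry f)) (hK : ∀ t, LipschitzWith K (f t))
    (hM : ∀ t, ‖f t 0‖ ≤ M) (x₀ : E) :
    ∃ X : ℝ → E, X 0 = x₀ ∧ ∀ t, HasDerivAt X (f t (X t)) t := by
  -- The integral gains `1 / c` and the right-hand side costs `K`; this choice makes `K / c ≤ 1/2`.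
  obtain ⟨c, hc⟩ : ∃ c : ℝ, c = 2 * (K + 1) := ⟨_, rfl⟩
  have hc0 : 0 < c := by rw [hc]; positivity
  have hM0 : 0 ≤ M := (norm_nonneg _).trans (hM 0)
  have hcont : ∀ u : BoundedContinuousFunction ℝ E,
      Continuous fun s => f s (Real.exp (c * |s|) • u s) := fun u =>
    hf.comp (continuous_id.prodMk (by fun_prop))
  have hbd : ∀ (u : BoundedContinuousFunction ℝ E) (s : ℝ),
      ‖f s (Real.exp (c * |s|) • u s)‖ ≤ (M + K * ‖u‖) * Real.exp (c * |s|) := by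
    intro u s
    have h1 : ‖f s (Real.exp (c * |s|) • u s) - f s 0‖ ≤ K * (Real.exp (c * |s|) * ‖u‖) := by
      refine ((hK s).norm_sub_le _ _).trans ?_
      rw [sub_zero, norm_smul, Real.norm_eq_abs, Real.abs_exp]
      gcongr
      exact u.norm_coe_le_norm s
    have h2 : 1 ≤ Real.exp (c * |s|) := Real.one_le_exp (by positivity)
    have h3 := norm_le_norm_sub_add (f s (Real.exp (c * |s|) • u s)) (f s 0)
    nlinarith [hM s]
  -- Picard's operator for the rescaled unknown `u = exp (-c|t|) X`, which is bounded even if `X`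
  -- grows exponentially.
  let Q : BoundedContinuousFunction ℝ E → BoundedContinuousFunction ℝ E := fun u =>
    BoundedContinuousFunction.ofNormedAddCommGroup
      (fun t => Real.exp (-(c * |t|)) •
        (x₀ + ∫ s in (0 : ℝ)..t, f s (Real.exp (c * |s|) • u s)))
      (by
        have := intervalIntegral.continuous_primitive
          (fun a b => (hcont u).intervalIntegrable (μ := volume) a b) 0
        fun_prop)
      (‖x₀‖ + (M + K * ‖u‖) / c)
      (by
        intro t
        have h1 := norm_integral_le_of_norm_le_exp_abs hc0 (by positivity) (hbd u) t
        have h2 : 1 ≤ Real.exp (c * |t|) := Real.one_le_exp (by positivity)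
        rw [norm_smul, Real.norm_eq_abs, Real.abs_exp, Real.exp_neg,
          inv_mul_le_iff₀ (Real.exp_pos _)]
        refine (norm_add_le _ _).trans ?_
        nlinarith [norm_nonneg x₀])
  have hQa : ∀ u t, Q u t = Real.exp (-(c * |t|)) •
      (x₀ + ∫ s in (0 : ℝ)..t, f s (Real.exp (c * |s|) • u s)) := fun _ _ => rfl
  have hQ : ContractingWith (1 / 2) Q := by
    refine ⟨by norm_num, LipschitzWith.of_dist_le_mul fun u v => ?_⟩
    rw [BoundedContinuousFunction.dist_le (by positivity)]
    intro t
    have hd : ∀ s, ‖u s - v s‖ ≤ dist u v := fun s => by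
      simpa [dist_eq_norm] using BoundedContinuousFunction.dist_coe_le_dist (f := u) (g := v) s
    have h1 : ∀ s, ‖f s (Real.exp (c * |s|) • u s) - f s (Real.exp (c * |s|) • v s)‖ ≤
        (K * dist u v) * Real.exp (c * |s|) := by
      intro s
      refine ((hK s).norm_sub_le _ _).trans ?_
      rw [← smul_sub, norm_smul, Real.norm_eq_abs, Real.abs_exp, mul_assoc,
        mul_comm (dist u v)]
      gcongr
      exact hd s
    have h2 := norm_integral_le_of_norm_le_exp_abs hc0 (by positivity) h1 t
    rw [intervalIntegral.integral_sub ((hcont u).intervalIntegrable _ _)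
      ((hcont v).intervalIntegrable _ _)] at h2
    rw [hQa, hQa, dist_eq_norm, ← smul_sub, add_sub_add_left_eq_sub, norm_smul, Real.norm_eq_abs,
      Real.abs_exp, Real.exp_neg, inv_mul_le_iff₀ (Real.exp_pos _), mul_comm (Real.exp _)]
    refine h2.trans ?_
    gcongr
    rw [div_le_iff₀ hc0, hc]
    push_cast
    nlinarith [dist_nonneg (x := u) (y := v), K.coe_nonneg]
  obtain ⟨u, hu⟩ : ∃ u, Q u = u := ⟨_, hQ.fixedPoint_isFixedPt⟩
  have hX : ∀ t, Real.exp (c * |t|) • u t =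
      x₀ + ∫ s in (0 : ℝ)..t, f s (Real.exp (c * |s|) • u s) := by
    intro t
    have h : u t = Real.exp (-(c * |t|)) •
        (x₀ + ∫ s in (0 : ℝ)..t, f s (Real.exp (c * |s|) • u s)) := by
      conv_lhs => rw [← hu]
      exact hQa u t
    conv_lhs => rw [h]
    rw [smul_smul, ← Real.exp_add, add_neg_cancel, Real.exp_zero, one_smul]
  refine ⟨fun t => Real.exp (c * |t|) • u t, by simpa using hX 0, fun t => ?_⟩
  have h1 := ((intervalIntegral.integral_hasDerivAt_right
    ((hcont u).intervalIntegrable 0 t)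
    ((hcont u).stronglyMeasurableAtFilter _ _) (hcont u).continuousAt).const_add x₀)
  exact h1.congr_of_eventuallyEq (Eventually.of_forall hX)

/-- Grönwall's inequality on both sides of the initial time. -/
theorem norm_le_gronwallBound_abs {u u' : ℝ → E} {K ε S δ : ℝ}
    (hu : ∀ t, HasDerivAt u (u' t) t) (h0 : ‖u 0‖ ≤ δ)
    (h : ∀ t, |t| ≤ S → ‖u' t‖ ≤ K * ‖u t‖ + ε) {t : ℝ} (ht : |t| ≤ S) :
    ‖u t‖ ≤ gronwallBound δ K ε |t| := by
  rcases le_total 0 t with h0t | h0t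
  · rw [abs_of_nonneg h0t] at ht ⊢
    have := norm_le_gronwallBound_of_norm_deriv_right_le (f := u) (f' := u') (a := 0) (b := S)
      (K := K) (ε := ε) (δ := δ)
      (fun s _ => (hu s).continuousAt.continuousWithinAt) (fun s _ => (hu s).hasDerivWithinAt)
      h0 (fun s hs => h s (by rw [abs_of_nonneg hs.1]; exact hs.2.le)) t ⟨h0t, ht⟩
    simpa using this
  · rw [abs_of_nonpos h0t] at ht ⊢
    have hd : ∀ s, HasDerivAt (fun s => u (-s)) (-u' (-s)) s := fun s => by
      simpa [Function.comp_def] using (hu (-s)).scomp s (hasDerivAt_neg s)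
    have := norm_le_gronwallBound_of_norm_deriv_right_le (f := fun s => u (-s))
      (f' := fun s => -u' (-s)) (a := 0) (b := S) (K := K) (ε := ε) (δ := δ)
      (fun s _ => (hd s).continuousAt.continuousWithinAt) (fun s _ => (hd s).hasDerivWithinAt)
      (by simpa using h0)
      (fun s hs => by
        simpa using h (-s) (by rw [abs_neg, abs_of_nonneg hs.1]; exact hs.2.le)) (-t)
      ⟨by linarith, ht⟩
    simpa using this

end GlobalODE

/-! ### The flow of a Lipschitz `C¹` field and its derivative -/

section Flow

variable {E : Type*} [NormedAddCommGroup E] [NormedSpace ℝ E]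

/-- The flow map of the autonomous vector field `a`, defined for all times. -/
noncomputable def flow (a : E → E) (t : ℝ) (x : E) : E :=
  Classical.epsilon (fun X : ℝ → E => X 0 = x ∧ ∀ s, HasDerivAt X (a (X s)) s) t

/-- The solution of the variational equation along the trajectory of `x`. -/
noncomputable def flowDeriv (a : E → E) (t : ℝ) (x : E) : E →L[ℝ] E :=
  Classical.epsilon (fun W : ℝ → E →L[ℝ] E => W 0 = ContinuousLinearMap.id ℝ E ∧
    ∀ s, HasDerivAt W ((fderiv ℝ a (flow a s x)).comp (W s)) s) t

variable [CompleteSpace E] {a : E → E} {K : ℝ≥0}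

theorem flow_spec (hL : LipschitzWith K a) (x : E) :
    flow a 0 x = x ∧ ∀ t, HasDerivAt (fun t => flow a t x) (a (flow a t x)) t :=
  Classical.epsilon_spec (p := fun X : ℝ → E => X 0 = x ∧ ∀ s, HasDerivAt X (a (X s)) s)
    (exists_forall_hasDerivAt_of_lipschitzWith (f := fun _ => a) (hL.continuous.comp continuous_snd)
      (fun _ => hL) (fun _ => le_rfl) x)

attribute [irreducible] flow

theorem flow_zero (hL : LipschitzWith K a) (x : E) : flow a 0 x = x := (flow_spec hL x).1

theorem hasDerivAt_flow (hL : LipschitzWith K a) (x : E) (t : ℝ) :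
    HasDerivAt (fun t => flow a t x) (a (flow a t x)) t := (flow_spec hL x).2 t

theorem flow_unique (hL : LipschitzWith K a) {x : E} {X : ℝ → E} (h0 : X 0 = x)
    (hX : ∀ t, HasDerivAt X (a (X t)) t) (t : ℝ) : X t = flow a t x := by
  have := ODE_solution_unique_univ (v := fun _ => a) (s := fun _ => univ) (K := K) (t₀ := 0)
    (f := X) (g := fun t => flow a t x) (fun _ => hL.lipschitzOnWith)
    (fun t => ⟨hX t, mem_univ _⟩) (fun t => ⟨hasDerivAt_flow hL x t, mem_univ _⟩)
    (by rw [h0, flow_zero hL])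
  exact congrFun this t

theorem flow_add (hL : LipschitzWith K a) (s t : ℝ) (x : E) :
    flow a (s + t) x = flow a s (flow a t x) :=
  flow_unique hL (X := fun s => flow a (s + t) x) (by simp)
    (fun s => (hasDerivAt_flow hL x (s + t)).comp_add_const s t) s

theorem flow_neg_flow (hL : LipschitzWith K a) (t : ℝ) (x : E) :
    flow a (-t) (flow a t x) = x := by
  rw [← flow_add hL, neg_add_cancel, flow_zero hL]

theorem flow_flow_neg (hL : LipschitzWith K a) (t : ℝ) (x : E) :
    flow a t (flow a (-t) x) = x := by
  rw [← flow_add hL, add_neg_cancel, flow_zero hL]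

theorem continuous_flow_left (hL : LipschitzWith K a) (x : E) :
    Continuous fun t => flow a t x :=
  continuous_iff_continuousAt.2 fun t => (hasDerivAt_flow hL x t).continuousAt

theorem norm_flow_sub_flow_le (hL : LipschitzWith K a) (t : ℝ) (x y : E) :
    ‖flow a t x - flow a t y‖ ≤ ‖x - y‖ * Real.exp (K * |t|) := by
  rw [← gronwallBound_ε0]
  refine norm_le_gronwallBound_abs (S := |t|)
    (fun s => (hasDerivAt_flow hL x s).sub (hasDerivAt_flow hL y s))
    (by simp [flow_zero hL]) (fun s _ => ?_) le_rfl
  simpa using hL.norm_sub_le _ _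

theorem continuous_flow (hL : LipschitzWith K a) : Continuous fun p : ℝ × E => flow a p.1 p.2 := by
  rw [continuous_iff_continuousAt]
  rintro ⟨t₀, x₀⟩
  refine tendsto_iff_norm_sub_tendsto_zero.2 ?_
  have h : Tendsto (fun p : ℝ × E => ‖p.2 - x₀‖ * Real.exp (K * |p.1|) +
      ‖flow a p.1 x₀ - flow a t₀ x₀‖) (𝓝 (t₀, x₀)) (𝓝 0) := by
    have hc := continuous_flow_left hL x₀
    have : Continuous (fun p : ℝ × E => ‖p.2 - x₀‖ * Real.exp (K * |p.1|) +
      ‖flow a p.1 x₀ - flow a t₀ x₀‖) := by fun_prop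
    simpa using this.tendsto (t₀, x₀)
  refine squeeze_zero (fun _ => norm_nonneg _) (fun p => ?_) h
  refine (norm_sub_le_norm_sub_add_norm_sub _ (flow a p.1 x₀) _).trans ?_
  gcongr
  exact norm_flow_sub_flow_le hL _ _ _

variable (ha : ContDiff ℝ 1 a)
include ha

theorem flowDeriv_spec (hL : LipschitzWith K a) (x : E) :
    flowDeriv a 0 x = ContinuousLinearMap.id ℝ E ∧
      ∀ t, HasDerivAt (fun t => flowDeriv a t x)
        ((fderiv ℝ a (flow a t x)).comp (flowDeriv a t x)) t := by
  have hA : Continuous fun t => fderiv ℝ a (flow a t x) :=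
    (ha.continuous_fderiv one_ne_zero).comp (continuous_flow_left hL x)
  have hlip : ∀ t, LipschitzWith K
      fun W : E →L[ℝ] E => (fderiv ℝ a (flow a t x)).comp W := by
    intro t
    refine LipschitzWith.of_dist_le_mul fun V W => ?_
    rw [dist_eq_norm, dist_eq_norm, ← ContinuousLinearMap.comp_sub]
    refine (ContinuousLinearMap.opNorm_comp_le _ _).trans ?_
    gcongr
    exact norm_fderiv_le_of_lipschitz ℝ hL
  have hcont : Continuous (Function.uncurry
      fun t (W : E →L[ℝ] E) => (fderiv ℝ a (flow a t x)).comp W) :=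
    (hA.comp continuous_fst).clm_comp continuous_snd
  have hex := exists_forall_hasDerivAt_of_lipschitzWith hcont hlip (M := 0)
    (fun t => by simp) (ContinuousLinearMap.id ℝ E)
  exact Classical.epsilon_spec hex

attribute [irreducible] flowDeriv

theorem norm_flowDeriv_le (hL : LipschitzWith K a) (t : ℝ) (x : E) :
    ‖flowDeriv a t x‖ ≤ Real.exp (K * |t|) := by
  have h := norm_le_gronwallBound_abs (S := |t|) (K := K) (ε := 0) (δ := 1)
    (flowDeriv_spec ha hL x).2 (by
      rw [(flowDeriv_spec ha hL x).1]; exact ContinuousLinearMap.norm_id_le)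
    (fun s _ => by
      rw [add_zero]
      refine (ContinuousLinearMap.opNorm_comp_le _ _).trans ?_
      gcongr
      exact norm_fderiv_le_of_lipschitz ℝ hL) le_rfl
  simpa [gronwallBound_ε0] using h

/-- The derivative of `a` is uniformly continuous along a compact piece of a trajectory. -/
theorem exists_norm_fderiv_sub_le_near_flow (hL : LipschitzWith K a) (S : ℝ) (x : E) {ε : ℝ}
    (hε : 0 < ε) : ∃ δ > 0, ∀ s, |s| ≤ S → ∀ z, ‖z - flow a s x‖ < δ →
      ‖fderiv ℝ a z - fderiv ℝ a (flow a s x)‖ < ε := by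
  have hc : IsCompact ((fun s => flow a s x) '' Icc (-S) S) :=
    isCompact_Icc.image (continuous_flow_left hL x)
  have h := hc.uniformContinuousAt_of_continuousAt (fderiv ℝ a)
    (fun y _ => (ha.continuous_fderiv one_ne_zero).continuousAt)
    (Metric.dist_mem_uniformity hε)
  obtain ⟨δ, hδ, h⟩ := Metric.mem_uniformity_dist.1 h
  refine ⟨δ, hδ, fun s hs z hz => ?_⟩
  rw [← dist_eq_norm, dist_comm]
  exact @h (flow a s x) z (by rwa [dist_comm, dist_eq_norm]) (mem_image_of_mem _ (abs_le.1 hs))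

/-- The linearisation error `Φ_s y - Φ_s x - W_s (y - x)` starts at zero and solves the variational
equation up to a forcing that is `o(‖y - x‖)` uniformly in `s`; Grönwall preserves this order. -/
theorem hasFDerivAt_flow (hL : LipschitzWith K a) (t : ℝ) (x : E) :
    HasFDerivAt (flow a t) (flowDeriv a t x) x := by
  -- Grönwall's bound at time `t` for zero initial value and forcing `exp (K|t|)`. Forcing scaled by
  -- `η / (C + 1)` then yields at most `η`; the `+ 1` avoids dividing by zero.
  set C : ℝ := gronwallBound 0 K (Real.exp (K * |t|)) |t| with hC
  rw [hasFDerivAt_iff_isLittleO, Asymptotics.isLittleO_iff]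
  intro η hη
  have hCnn : 0 ≤ C := by
    have := gronwallBound_mono (δ := 0) (ε := Real.exp (K * |t|)) (K := K) le_rfl
      (Real.exp_pos _).le K.coe_nonneg (abs_nonneg t)
    simpa [gronwallBound_x0] using this
  obtain ⟨δ, hδ, hd⟩ := exists_norm_fderiv_sub_le_near_flow ha hL |t| x
    (ε := η / (C + 1)) (by positivity)
  have hnear : ∀ᶠ y in 𝓝 x, ‖y - x‖ * Real.exp (K * |t|) < δ := by
    have : Continuous fun y => ‖y - x‖ * Real.exp (K * |t|) := by fun_prop
    exact this.continuousAt.eventually_lt continuousAt_const (by simpa using hδ)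
  filter_upwards [hnear] with y hy
  have hsmall : ∀ s, |s| ≤ |t| → ‖flow a s y - flow a s x‖ ≤ ‖y - x‖ * Real.exp (K * |t|) :=
    fun s hs => (norm_flow_sub_flow_le hL s y x).trans (by gcongr)
  have hb := norm_le_gronwallBound_abs (S := |t|) (K := K) (δ := 0)
    (ε := η / (C + 1) * (‖y - x‖ * Real.exp (K * |t|)))
    (u := fun s => flow a s y - flow a s x - flowDeriv a s x (y - x))
    (fun s => ((hasDerivAt_flow hL y s).sub (hasDerivAt_flow hL x s)).sub
      (((flowDeriv_spec ha hL x).2 s).clm_apply (hasDerivAt_const s (y - x))))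
    (by simp [flow_zero hL, (flowDeriv_spec ha hL x).1])
    (fun s hs => ?_) le_rfl
  · refine hb.trans ?_
    -- With zero initial value the bound is linear in the forcing; the case split is on `K = 0`.
    have hlin : gronwallBound 0 K (η / (C + 1) * (‖y - x‖ * Real.exp (K * |t|))) |t| =
        η / (C + 1) * ‖y - x‖ * C := by
      rw [hC]
      simp only [gronwallBound]
      split_ifs <;> ring
    rw [hlin]
    have : η / (C + 1) * C ≤ η := by
      rw [div_mul_eq_mul_div, div_le_iff₀ (by positivity)]
      nlinarith
    nlinarith [norm_nonneg (y - x)]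
  · have hmv : ‖a (flow a s y) - a (flow a s x) -
        fderiv ℝ a (flow a s x) (flow a s y - flow a s x)‖ ≤
        η / (C + 1) * ‖flow a s y - flow a s x‖ := by
      refine (convex_ball (flow a s x) δ).norm_image_sub_le_of_norm_fderiv_le'
        (fun z _ => ha.differentiable one_ne_zero z)
        (fun z hz => (hd s hs z (mem_ball_iff_norm.1 hz)).le) (Metric.mem_ball_self hδ)
        (mem_ball_iff_norm.2 ((hsmall s hs).trans_lt hy))
    have hsplit : a (flow a s y) - a (flow a s x) -
        ((fderiv ℝ a (flow a s x)).comp (flowDeriv a s x) (y - x) + flowDeriv a s x 0) =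
        fderiv ℝ a (flow a s x) (flow a s y - flow a s x - flowDeriv a s x (y - x)) +
        (a (flow a s y) - a (flow a s x) -
          fderiv ℝ a (flow a s x) (flow a s y - flow a s x)) := by
      simp
    rw [hsplit]
    refine (norm_add_le _ _).trans (add_le_add ?_ (hmv.trans ?_))
    · exact (ContinuousLinearMap.le_opNorm _ _).trans
        (by gcongr; exact norm_fderiv_le_of_lipschitz ℝ hL)
    · gcongr
      exact hsmall s hs

/-- Two solutions of variational equations with the same initial value differ by the effect of the
coefficient gap `Da(Φ_s y) - Da(Φ_s x₀)`, which is uniformly small on a time window containing a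
neighbourhood of `t₀`. -/
theorem continuous_flowDeriv (hL : LipschitzWith K a) :
    Continuous fun p : ℝ × E => flowDeriv a p.1 p.2 := by
  rw [continuous_iff_continuousAt]
  rintro ⟨t₀, x₀⟩
  set S : ℝ := |t₀| + 1
  set C : ℝ := gronwallBound 0 K (Real.exp (K * S)) S with hC
  have hCnn : 0 ≤ C := by
    have := gronwallBound_mono (δ := 0) (ε := Real.exp (K * S)) (K := K) le_rfl
      (Real.exp_pos _).le K.coe_nonneg (show (0 : ℝ) ≤ S by positivity)
    simpa [gronwallBound_x0] using this
  have hclose : Tendsto (fun p : ℝ × E => flowDeriv a p.1 p.2 - flowDeriv a p.1 x₀)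
      (𝓝 (t₀, x₀)) (𝓝 0) := by
    rw [Metric.tendsto_nhds]
    intro η hη
    obtain ⟨δ, hδ, hd⟩ := exists_norm_fderiv_sub_le_near_flow ha hL S x₀
      (ε := η / (C + 1)) (by positivity)
    have h1 : ∀ᶠ p : ℝ × E in 𝓝 (t₀, x₀), ‖p.2 - x₀‖ * Real.exp (K * S) < δ := by
      have : Continuous fun p : ℝ × E => ‖p.2 - x₀‖ * Real.exp (K * S) := by fun_prop
      exact this.continuousAt.eventually_lt continuousAt_const (by simpa using hδ)
    have h2 : ∀ᶠ p : ℝ × E in 𝓝 (t₀, x₀), |p.1| < S := by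
      have : Continuous fun p : ℝ × E => |p.1| := by fun_prop
      exact this.continuousAt.eventually_lt continuousAt_const (by simp [S])
    filter_upwards [h1, h2] with p hp1 hp2
    rw [dist_zero_right]
    have hb := norm_le_gronwallBound_abs (S := S) (K := K) (δ := 0)
      (ε := η / (C + 1) * Real.exp (K * S))
      (u := fun s => flowDeriv a s p.2 - flowDeriv a s x₀)
      (fun s => ((flowDeriv_spec ha hL p.2).2 s).sub ((flowDeriv_spec ha hL x₀).2 s))
      (by simp [(flowDeriv_spec ha hL _).1]) (fun s hs => ?_) hp2.le
    · have hmono := gronwallBound_mono (δ := 0) (ε := η / (C + 1) * Real.exp (K * S)) (K := K)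
        le_rfl (by positivity) K.coe_nonneg hp2.le
      have hlin : gronwallBound 0 K (η / (C + 1) * Real.exp (K * S)) S = η / (C + 1) * C := by
        rw [hC]
        simp only [gronwallBound]
        split_ifs <;> ring
      have : η / (C + 1) * C < η := by
        rw [div_mul_eq_mul_div, div_lt_iff₀ (by positivity)]
        nlinarith
      linarith
    · have hsplit : (fderiv ℝ a (flow a s p.2)).comp (flowDeriv a s p.2) -
          (fderiv ℝ a (flow a s x₀)).comp (flowDeriv a s x₀) =
          (fderiv ℝ a (flow a s p.2)).comp (flowDeriv a s p.2 - flowDeriv a s x₀) +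
          (fderiv ℝ a (flow a s p.2) - fderiv ℝ a (flow a s x₀)).comp (flowDeriv a s x₀) := by
        rw [ContinuousLinearMap.comp_sub, ContinuousLinearMap.sub_comp]
        abel
      rw [hsplit]
      refine (norm_add_le _ _).trans (add_le_add ?_ ?_)
      · exact (ContinuousLinearMap.opNorm_comp_le _ _).trans
          (by gcongr; exact norm_fderiv_le_of_lipschitz ℝ hL)
      · refine (ContinuousLinearMap.opNorm_comp_le _ _).trans ?_
        gcongr
        · refine (hd s hs _ ?_).le
          refine lt_of_le_of_lt ?_ hp1
          exact (norm_flow_sub_flow_le hL s _ _).trans (by gcongr)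
        · exact (norm_flowDeriv_le ha hL s x₀).trans (by gcongr)
  have hleft : Tendsto (fun p : ℝ × E => flowDeriv a p.1 x₀) (𝓝 (t₀, x₀))
      (𝓝 (flowDeriv a t₀ x₀)) :=
    ((flowDeriv_spec ha hL x₀).2 t₀).continuousAt.tendsto.comp continuous_fst.continuousAt
  simpa [ContinuousAt] using hclose.add hleft

theorem contDiff_flow (hL : LipschitzWith K a) :
    ContDiff ℝ 1 fun p : ℝ × E => flow a p.1 p.2 := by
  have hc1 : Continuous fun p : ℝ × E =>
      ContinuousLinearMap.toSpanSingleton ℝ (a (flow a p.1 p.2)) :=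
    (ContinuousLinearMap.toSpanSingletonCLE (𝕜 := ℝ) (E := E)).continuous.comp
      (hL.continuous.comp (continuous_flow hL))
  have hc2 := continuous_flowDeriv ha hL
  refine contDiff_one_iff_hasFDerivAt.2 ⟨fun p =>
    (ContinuousLinearMap.toSpanSingleton ℝ (a (flow a p.1 p.2))).coprod (flowDeriv a p.1 p.2),
    ?_, fun p => ?_⟩
  · fun_prop
  · exact (hasStrictFDerivAt_uncurry_coprod (𝕜 := ℝ) (f := flow a) (u := p)
      (f₁ := fun t x => ContinuousLinearMap.toSpanSingleton ℝ (a (flow a t x)))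
      (f₂ := flowDeriv a)
      (Eventually.of_forall fun q => (hasDerivAt_flow hL q.2 q.1).hasFDerivAt)
      (Eventually.of_forall fun q => hasFDerivAt_flow ha hL q.1 q.2)
      hc1.continuousAt hc2.continuousAt).hasFDerivAt

/-- The flow preserves its generating vector field. -/
theorem flowDeriv_apply_field (hL : LipschitzWith K a) (t : ℝ) (x : E) :
    flowDeriv a t x (a x) = a (flow a t x) := by
  -- The function `r ↦ Φ_t (Φ_r x)` is differentiated at `r = 0` twice: by the chain rule, and as
  -- `Φ_{t+r} x` by the group law.
  have h1 : HasDerivAt (fun r => flow a t (flow a r x)) (flowDeriv a t x (a x)) 0 := by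
    have h := hasDerivAt_flow hL x 0
    have h2 := hasFDerivAt_flow ha hL t (flow a 0 x)
    have h3 := h2.comp_hasDerivAt (f := fun r => flow a r x) (0 : ℝ) h
    simpa [flow_zero hL, Function.comp_def] using h3
  have h2 : HasDerivAt (fun r => flow a t (flow a r x)) (a (flow a t x)) 0 := by
    simp_rw [← flow_add hL]
    simpa using (hasDerivAt_flow hL x (t + 0)).comp_const_add t 0
  exact h1.unique h2

end Flow

/-! ### The two adjoint problems -/

section Adjoint

variable {d : ℕ} {a : Vec d → Vec d} {ν : Vec d → ℝ} {K : ℝ≥0} {T : ℝ}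

theorem IsC1BddDeriv.exists_lipschitzWith {F : Type*} [NormedAddCommGroup F] [NormedSpace ℝ F]
    {h : Vec d → F} (hh : IsC1BddDeriv h) : ∃ K : ℝ≥0, LipschitzWith K h := by
  obtain ⟨h1, K, hK⟩ := hh
  refine ⟨K.toNNReal, lipschitzWith_of_nnnorm_fderiv_le (𝕜 := ℝ)
    (h1.differentiable one_ne_zero) fun x => ?_⟩
  rw [← NNReal.coe_le_coe]
  exact (hK x).trans (Real.le_coe_toNNReal K)

theorem IsC1BddDeriv.add_smul {φ : Vec d → Vec d} (ha : IsC1BddDeriv a) (hφ : IsC1BddDeriv φ)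
    (ε : ℝ) : IsC1BddDeriv (a + ε • φ) := by
  obtain ⟨ha, K, hK⟩ := ha
  obtain ⟨hφ, K', hK'⟩ := hφ
  refine ⟨ha.add (hφ.const_smul ε), K + |ε| * K', fun x => ?_⟩
  have hd : DifferentiableAt ℝ (ε • φ) x := (hφ.const_smul ε).differentiable one_ne_zero x
  rw [fderiv_add (ha.differentiable one_ne_zero x) hd,
    fderiv_const_smul (hφ.differentiable one_ne_zero x)]
  refine (norm_add_le _ _).trans (add_le_add (hK x) ?_)
  rw [norm_smul, Real.norm_eq_abs]
  exact mul_le_mul_of_nonneg_left (hK' x) (abs_nonneg ε)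

theorem isCharacteristic_flow (hL : LipschitzWith K a) (T : ℝ) (x : Vec d) :
    IsCharacteristic T a x fun t => flow a t x :=
  ⟨flow_zero hL x, fun t _ => (hasDerivAt_flow hL x t).hasDerivWithinAt⟩

theorem IsCharacteristic.eq_flow (hL : LipschitzWith K a) {x : Vec d} {X : ℝ → Vec d}
    (hX : IsCharacteristic T a x X) : ∀ t ∈ Icc 0 T, X t = flow a t x := by
  refine ODE_solution_unique (v := fun _ => a) (K := K) (fun _ => hL)
    (fun t ht => (hX.2 t ht).continuousWithinAt)
    (fun t ht => (hX.2 t (Ico_subset_Icc_self ht)).mono_of_mem_nhdsWithin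
      (Icc_mem_nhdsGE_of_mem ht))
    (continuous_flow_left hL x).continuousOn
    (fun t _ => (hasDerivAt_flow hL x t).hasDerivWithinAt) (by rw [hX.1, flow_zero hL])

theorem particleObjective_eq (hL : LipschitzWith K a) (hT : 0 ≤ T) (ν : Vec d → ℝ) (x : Vec d) :
    particleObjective T ν x a = ν (flow a T x) := by
  have h : IsCharacteristic T a x (characteristic T a x) :=
    Classical.epsilon_spec (p := IsCharacteristic T a x) ⟨_, isCharacteristic_flow hL T x⟩
  rw [particleObjective, h.eq_flow hL T ⟨hT, le_rfl⟩]

/-- The spatial derivative at `x` of the backward solution `x ↦ ν (Φ_{T - t} x)`. -/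
noncomputable def sensitivity (T : ℝ) (a : Vec d → Vec d) (ν : Vec d → ℝ) (t : ℝ) (x : Vec d) :
    Vec d →L[ℝ] ℝ :=
  (fderiv ℝ ν (flow a (T - t) x)).comp (flowDeriv a (T - t) x)

theorem hasFDerivAt_backward (ha : ContDiff ℝ 1 a) (hL : LipschitzWith K a) (hν : ContDiff ℝ 1 ν)
    (t : ℝ) (x : Vec d) :
    HasFDerivAt (fun y => ν (flow a (T - t) y)) (sensitivity T a ν t x) x :=
  (hν.differentiable one_ne_zero _).hasFDerivAt.comp x (hasFDerivAt_flow ha hL _ x)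

theorem continuous_sensitivity (ha : ContDiff ℝ 1 a) (hL : LipschitzWith K a)
    (hν : ContDiff ℝ 1 ν) : Continuous fun p : ℝ × Vec d => sensitivity T a ν p.1 p.2 := by
  have h1 : Continuous fun p : ℝ × Vec d => (T - p.1, p.2) := by fun_prop
  exact ((hν.continuous_fderiv one_ne_zero).comp ((continuous_flow hL).comp h1)).clm_comp
    ((continuous_flowDeriv ha hL).comp h1)

theorem exists_norm_sensitivity_le (ha : ContDiff ℝ 1 a) (hL : LipschitzWith K a)
    (hν : IsC1BddDeriv ν) :
    ∃ C, 0 ≤ C ∧ ∀ t ∈ Icc 0 T, ∀ x, ‖sensitivity T a ν t x‖ ≤ C := by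
  obtain ⟨-, Kν, hKν⟩ := hν
  have hK0 : 0 ≤ Kν := (norm_nonneg _).trans (hKν 0)
  refine ⟨Kν * Real.exp (K * T), by positivity, fun t ht x => ?_⟩
  refine (ContinuousLinearMap.opNorm_comp_le _ _).trans ?_
  gcongr
  · exact hKν _
  · refine (norm_flowDeriv_le ha hL _ _).trans ?_
    gcongr
    rw [abs_of_nonneg (by linarith [ht.2])]
    linarith [ht.1]

/-- Because the flow carries `a` to itself, `Dν(a(Φ_{T-t} x))` equals `∇g(t,x)·a(x)`: this is the
adjoint equation for `g`. -/
theorem hasDerivAt_backward_time (ha : ContDiff ℝ 1 a) (hL : LipschitzWith K a)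
    (hν : ContDiff ℝ 1 ν) (t : ℝ) (x : Vec d) :
    HasDerivAt (fun s => ν (flow a (T - s) x)) (-(sensitivity T a ν t x (a x))) t := by
  have h1 : HasDerivAt (fun s => flow a (T - s) x) (-a (flow a (T - t) x)) t := by
    simpa using (hasDerivAt_flow hL x (T - t)).comp_const_sub T t
  have h2 := (hν.differentiable one_ne_zero (flow a (T - t) x)).hasFDerivAt.comp_hasDerivAt
    (f := fun s => flow a (T - s) x) t h1
  refine h2.congr_deriv ?_
  simp [sensitivity, flowDeriv_apply_field ha hL]

theorem contDiff_backward (ha : ContDiff ℝ 1 a) (hL : LipschitzWith K a) (hν : ContDiff ℝ 1 ν) :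
    ContDiff ℝ 1 fun p : ℝ × Vec d => ν (flow a (T - p.1) p.2) := by
  have h1 : ContDiff ℝ 1 fun p : ℝ × Vec d => (T - p.1, p.2) := by fun_prop
  exact hν.comp ((contDiff_flow ha hL).comp h1)

theorem isPDEAdjoint_backward (ha : ContDiff ℝ 1 a) (hL : LipschitzWith K a)
    (hν : ContDiff ℝ 1 ν) : IsPDEAdjoint T a ν fun t x => ν (flow a (T - t) x) := by
  refine ⟨(contDiff_backward ha hL hν).contDiffOn, fun t _ x => ?_, fun x => ?_⟩
  · rw [(hasFDerivAt_backward ha hL hν t x).fderiv]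
    exact (hasDerivAt_backward_time ha hL hν t x).hasDerivWithinAt
  · simp [flow_zero hL]

/-- Method of characteristics: `g` is constant along trajectories, and each `(t, x)` lies on the one
issued from `Φ_{-t} x`. -/
theorem IsPDEAdjoint.eq_backward (hL : LipschitzWith K a) (hT : 0 < T) {g : ℝ → Vec d → ℝ}
    (hg : IsPDEAdjoint T a ν g) : ∀ t ∈ Icc 0 T, g t = fun x => ν (flow a (T - t) x) := by
  obtain ⟨hC, ht, hend⟩ := hg
  have hU : UniqueDiffOn ℝ (Icc 0 T) := uniqueDiffOn_Icc hT
  -- The equation is given through separate partial derivatives; they are combined into the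
  -- vanishing of the joint derivative in direction `(1, a x)`. Derivatives are taken within the
  -- strip, so that the end times are covered; they are unique there because `T > 0`.
  have hzero : ∀ t ∈ Icc 0 T, ∀ x : Vec d,
      ∃ G : ℝ × Vec d →L[ℝ] ℝ, G (1, a x) = 0 ∧
        HasFDerivWithinAt (fun p : ℝ × Vec d => g p.1 p.2) G (Icc 0 T ×ˢ univ) (t, x) := by
    intro t htT x
    have hG := (hC.differentiableOn one_ne_zero (t, x) ⟨htT, mem_univ _⟩).hasFDerivWithinAt
    set G := fderivWithin ℝ (fun p : ℝ × Vec d => g p.1 p.2) (Icc 0 T ×ˢ univ) (t, x)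
    refine ⟨G, ?_, hG⟩
    have h1 : HasDerivWithinAt (fun s => g s x) (G (1, 0)) (Icc 0 T) t := by
      have hc : HasDerivWithinAt (fun s : ℝ => (s, x)) ((1 : ℝ), (0 : Vec d)) (Icc 0 T) t :=
        ((hasDerivAt_id t).prodMk (hasDerivAt_const t x)).hasDerivWithinAt
      exact hG.comp_hasDerivWithinAt (f := fun s : ℝ => (s, x)) t hc
        fun s hs => ⟨hs, mem_univ _⟩
    have h2 : HasFDerivAt (g t) (G.comp (ContinuousLinearMap.inr ℝ ℝ (Vec d))) x := by
      have hc : HasFDerivWithinAt (fun y : Vec d => (t, y)) (ContinuousLinearMap.inr ℝ ℝ (Vec d))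
          univ x := (hasFDerivAt_prodMk_right t x).hasFDerivWithinAt
      exact hasFDerivWithinAt_univ.1
        (HasFDerivWithinAt.comp (f := fun y : Vec d => (t, y)) x hG hc
          fun s hs => ⟨htT, mem_univ _⟩)
    have h3 := (hU t htT).eq_deriv _ h1 (ht t htT x)
    rw [h2.fderiv] at h3
    have h4 : ((1 : ℝ), a x) = (1, 0) + (0, a x) := by simp
    rw [h4, map_add, h3]
    simp
  have hconst : ∀ x : Vec d, ∀ t ∈ Icc 0 T, g t (flow a t x) = g 0 (flow a 0 x) := by
    intro x
    have hd : ∀ t ∈ Icc 0 T, HasDerivWithinAt (fun t => g t (flow a t x)) 0 (Icc 0 T) t := by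
      intro t htT
      obtain ⟨G, hG0, hG⟩ := hzero t htT (flow a t x)
      have hc : HasDerivWithinAt (fun s : ℝ => (s, flow a s x)) ((1 : ℝ), a (flow a t x))
          (Icc 0 T) t :=
        ((hasDerivAt_id t).prodMk (hasDerivAt_flow hL x t)).hasDerivWithinAt
      exact (hG.comp_hasDerivWithinAt (f := fun s : ℝ => (s, flow a s x)) t hc
        fun s hs => ⟨hs, mem_univ _⟩).congr_deriv hG0
    exact constant_of_derivWithin_zero (fun t htT => (hd t htT).differentiableWithinAt)
      fun t htT => (hd t (Ico_subset_Icc_self htT)).derivWithin (hU t (Ico_subset_Icc_self htT))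
  intro t htT
  funext x
  have h1 := hconst (flow a (-t) x) t htT
  have h2 := hconst (flow a (-t) x) T ⟨hT.le, le_rfl⟩
  rw [flow_flow_neg hL] at h1
  rw [← flow_add hL, hend, ← sub_eq_add_neg] at h2
  rw [h1, ← h2]

theorem IsPDEAdjoint.inner_gradient (ha : ContDiff ℝ 1 a) (hL : LipschitzWith K a)
    (hν : ContDiff ℝ 1 ν) (hT : 0 < T) {g : ℝ → Vec d → ℝ} (hg : IsPDEAdjoint T a ν g)
    {t : ℝ} (ht : t ∈ Icc 0 T) (x v : Vec d) :
    inner ℝ (gradient (g t) x) v = sensitivity T a ν t x v := by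
  rw [hg.eq_backward hL hT t ht, gradient, InnerProductSpace.toDual_symm_apply,
    (hasFDerivAt_backward ha hL hν t x).fderiv]

theorem exists_isParticleAdjoint (ha : ContDiff ℝ 1 a) (hL : LipschitzWith K a)
    (ν : Vec d → ℝ) {x : Vec d} {X : ℝ → Vec d} (hX : IsCharacteristic T a x X) :
    ∃ Y, IsParticleAdjoint T a ν X Y := by
  -- Time is shifted by `T`, so that the terminal condition becomes an initial one, and the flow
  -- replaces `X`, so that the coefficients exist for all times.
  have hA : Continuous fun t => ContinuousLinearMap.adjoint (fderiv ℝ a (flow a (t + T) x)) :=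
    (ContinuousLinearMap.adjoint (𝕜 := ℝ) (E := Vec d) (F := Vec d)).continuous.comp
      ((ha.continuous_fderiv one_ne_zero).comp
        ((continuous_flow_left hL x).comp (by fun_prop)))
  have hcont : Continuous (Function.uncurry fun t (y : Vec d) =>
      -(ContinuousLinearMap.adjoint (fderiv ℝ a (flow a (t + T) x)) y)) :=
    ((hA.comp continuous_fst).clm_apply continuous_snd).neg
  have hlip : ∀ t, LipschitzWith K fun y : Vec d =>
      -(ContinuousLinearMap.adjoint (fderiv ℝ a (flow a (t + T) x)) y) := by
    refine fun t => LipschitzWith.of_dist_le_mul fun y z => ?_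
    rw [dist_neg_neg, dist_eq_norm, ← map_sub, dist_eq_norm]
    refine (ContinuousLinearMap.le_opNorm _ _).trans ?_
    gcongr
    rw [LinearIsometryEquiv.norm_map]
    exact norm_fderiv_le_of_lipschitz ℝ hL
  obtain ⟨Z, hZ0, hZ⟩ := exists_forall_hasDerivAt_of_lipschitzWith hcont hlip (M := 0)
    (fun t => by simp) (gradient ν (X T))
  refine ⟨fun t => Z (t - T), fun t ht => ?_, by simpa using hZ0⟩
  have h := (hZ (t - T)).comp_sub_const t T
  rw [sub_add_cancel] at h
  rw [hX.eq_flow hL t ht]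
  exact h.hasDerivWithinAt

/-- Duality: the pairing of `Y` with a solution of the linearised equation is constant in time.
Comparing times `t` and `T` moves `v` forward by the linearised flow, where it meets `∇ν`. -/
theorem IsParticleAdjoint.inner_eq (ha : ContDiff ℝ 1 a) (hL : LipschitzWith K a) (hT : 0 < T)
    {x : Vec d} {X Y : ℝ → Vec d} (hX : IsCharacteristic T a x X)
    (hY : IsParticleAdjoint T a ν X Y) {t : ℝ} (ht : t ∈ Icc 0 T) (v : Vec d) :
    inner ℝ (Y t) v = sensitivity T a ν t (X t) v := by
  have hU : UniqueDiffOn ℝ (Icc 0 T) := uniqueDiffOn_Icc hT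
  have hflow : ∀ s ∈ Icc 0 T, flow a (s - t) (X t) = X s := fun s hs => by
    rw [hX.eq_flow hL t ht, hX.eq_flow hL s hs, ← flow_add hL, sub_add_cancel]
  have hd : ∀ s ∈ Icc 0 T,
      HasDerivWithinAt (fun s => inner ℝ (Y s) (flowDeriv a (s - t) (X t) v)) 0 (Icc 0 T) s := by
    intro s hs
    have hw : HasDerivAt (fun s => flowDeriv a (s - t) (X t) v)
        (fderiv ℝ a (X s) (flowDeriv a (s - t) (X t) v)) s := by
      have h := (((flowDeriv_spec ha hL (X t)).2 (s - t)).comp_sub_const s t).clm_apply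
        (hasDerivAt_const s v)
      simpa [hflow s hs] using h
    refine ((hY.1 s hs).inner ℝ hw.hasDerivWithinAt).congr_deriv ?_
    rw [inner_neg_left, ContinuousLinearMap.adjoint_inner_left]
    simp
  have hconst := constant_of_derivWithin_zero
    (fun s hs => (hd s hs).differentiableWithinAt)
    fun s hs => (hd s (Ico_subset_Icc_self hs)).derivWithin (hU s (Ico_subset_Icc_self hs))
  have h := (hconst t ht).trans (hconst T ⟨hT.le, le_rfl⟩).symm
  simp only [sub_self, (flowDeriv_spec ha hL _).1, ContinuousLinearMap.id_apply] at h
  rw [h, hY.2, gradient, InnerProductSpace.toDual_symm_apply, sensitivity,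
    ContinuousLinearMap.comp_apply, hflow T ⟨hT.le, le_rfl⟩]

end Adjoint

/-! ### Well-posedness of the transport equation -/

section Transport

/-- Finite measures on a Euclidean space are determined by their integrals against compactly
supported `C¹` functions. -/
theorem measure_ext_of_forall_integral_contDiff {d : ℕ} {μ μ' : Measure (Vec d)}
    [IsFiniteMeasure μ] [IsFiniteMeasure μ']
    (h : ∀ ψ : Vec d → ℝ, ContDiff ℝ 1 ψ → HasCompactSupport ψ → ∫ x, ψ x ∂μ = ∫ x, ψ x ∂μ') :
    μ = μ' := by
  have hopen : ∀ U : Set (Vec d), IsOpen U → μ U = μ' U := by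
    intro U hU
    obtain ⟨f, hfU, hf, hfr⟩ := hU.exists_contDiff_support_eq (n := 1)
    -- Cut-offs on growing balls, needed for compact support. Multiplied by a smooth step of `n *
    -- f`, where `f ≥ 0` is positive exactly on `U`, they converge pointwise to the indicator of
    -- `U`.
    let θ : ℕ → ContDiffBump (0 : Vec d) := fun n =>
      ⟨n + 1, n + 2, by positivity, by linarith⟩
    let ψ : ℕ → Vec d → ℝ := fun n x => Real.smoothTransition (n * f x) * θ n x
    have hψ : ∀ n, ContDiff ℝ 1 (ψ n) := fun n =>
      (Real.smoothTransition.contDiff.comp (contDiff_const.mul hf)).mul (θ n).contDiff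
    have hψs : ∀ n, HasCompactSupport (ψ n) := fun n => (θ n).hasCompactSupport.mul_left
    have hψ1 : ∀ n x, ‖ψ n x‖ ≤ 1 := fun n x => by
      rw [Real.norm_eq_abs, abs_of_nonneg
        (mul_nonneg (Real.smoothTransition.nonneg _) (θ n).nonneg)]
      exact mul_le_one₀ (Real.smoothTransition.le_one _) (θ n).nonneg (θ n).le_one
    have hlim : ∀ x, Tendsto (fun n => ψ n x) atTop (𝓝 (U.indicator (fun _ => (1 : ℝ)) x)) := by
      intro x
      by_cases hx : x ∈ U
      · have hfx : 0 < f x := lt_of_le_of_ne (hfr (mem_range_self x)).1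
          (Ne.symm (by rw [← hfU] at hx; exact hx))
        rw [indicator_of_mem hx]
        refine tendsto_const_nhds.congr' ?_
        obtain ⟨N, hN⟩ := exists_nat_ge (max (1 / f x) ‖x‖)
        filter_upwards [eventually_ge_atTop N] with n hn
        have hNn : (N : ℝ) ≤ n := Nat.cast_le.2 hn
        have h1 : 1 ≤ n * f x := by
          rw [← div_le_iff₀ hfx]
          exact (le_max_left _ _).trans (hN.trans hNn)
        have h2 : x ∈ Metric.closedBall (0 : Vec d) (θ n).rIn := by
          rw [mem_closedBall_zero_iff]
          have h3 := (le_max_right (1 / f x) ‖x‖).trans (hN.trans hNn)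
          change ‖x‖ ≤ (n : ℝ) + 1
          linarith
        simp only [ψ]
        rw [Real.smoothTransition.one_of_one_le h1, (θ n).one_of_mem_closedBall h2, one_mul]
      · have hfx : f x = 0 := by
          rw [← hfU] at hx
          exact Function.notMem_support.1 hx
        rw [indicator_of_notMem hx]
        simp [ψ, hfx, Real.smoothTransition.zero]
    have hint : ∀ (ρ : Measure (Vec d)) [IsFiniteMeasure ρ],
        Tendsto (fun n => ∫ x, ψ n x ∂ρ) atTop (𝓝 (ρ.real U)) := by
      intro ρ _
      have := tendsto_integral_of_dominated_convergence (μ := ρ) (fun _ => (1 : ℝ))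
        (fun n => (hψ n).continuous.aestronglyMeasurable) (integrable_const _)
        (fun n => Eventually.of_forall (hψ1 n)) (Eventually.of_forall hlim)
      simpa [integral_indicator hU.measurableSet] using this
    have h1 := hint μ
    simp_rw [fun n => h (ψ n) (hψ n) (hψs n)] at h1
    exact (measureReal_eq_measureReal_iff).1 (tendsto_nhds_unique h1 (hint μ'))
  exact ext_of_generate_finite {s | IsOpen s} (BorelSpace.measurable_eq) isPiSystem_isOpen
    hopen (hopen univ isOpen_univ)

variable {d : ℕ} {a : Vec d → Vec d} {K : ℝ≥0} {T : ℝ}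

theorem continuousOn_integral_of_continuousOn {f : ℝ → FiniteMeasure (Vec d)} {S : Set ℝ}
    (hf : ContinuousOn f S) {q : Vec d → ℝ} (hq : Continuous q) (hqs : HasCompactSupport q) :
    ContinuousOn (fun r => ∫ x, q x ∂(f r : Measure (Vec d))) S := by
  obtain ⟨C, hC⟩ := hq.bounded_above_of_compact_support hqs
  intro r hr
  exact FiniteMeasure.tendsto_iff_forall_integral_tendsto.1 (hf r hr)
    (BoundedContinuousFunction.ofNormedAddCommGroup q hq C hC)

theorem hasCompactSupport_fderiv_apply {ψ : Vec d → ℝ} (hψ : HasCompactSupport ψ)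
    (a : Vec d → Vec d) : HasCompactSupport fun x => fderiv ℝ ψ x (a x) :=
  (hψ.fderiv (𝕜 := ℝ)).mono' fun x hx => subset_tsupport _ fun h => hx (by
    change fderiv ℝ ψ x = 0 at h
    simp [h])

theorem HasCompactSupport.comp_flow (hL : LipschitzWith K a) {ψ : Vec d → ℝ}
    (hψ : HasCompactSupport ψ) (t : ℝ) : HasCompactSupport fun x => ψ (flow a t x) := by
  have hc : Continuous (flow a (-t)) := (continuous_flow hL).comp (by fun_prop :
    Continuous fun x : Vec d => (-t, x))
  refine HasCompactSupport.intro (IsCompact.image hψ hc) fun x hx => ?_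
  by_contra h
  exact hx ⟨flow a t x, subset_tsupport _ h, flow_neg_flow hL t x⟩

theorem isFiniteMeasure_restrict_uIoc (b c : ℝ) :
    IsFiniteMeasure (volume.restrict (uIoc b c)) :=
  ⟨by simp [uIoc]⟩

theorem continuous_flow_right (hL : LipschitzWith K a) (t : ℝ) : Continuous (flow a t) :=
  (continuous_flow hL).comp (by fun_prop : Continuous fun x : Vec d => (t, x))

/-- The push-forward of the initial datum by the flow solves the transport equation. -/
theorem isTransportSolution_map_flow (hL : LipschitzWith K a) (T : ℝ)
    (f₀ : FiniteMeasure (Vec d)) : IsTransportSolution T a f₀ fun t => f₀.map (flow a t) := by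
  have hmap : ∀ (t : ℝ) (q : Vec d → ℝ), Continuous q →
      ∫ x, q x ∂((f₀.map (flow a t) : FiniteMeasure (Vec d)) : Measure (Vec d)) =
        ∫ x, q (flow a t x) ∂(f₀ : Measure (Vec d)) := fun t q hq => by
    rw [FiniteMeasure.toMeasure_map]
    exact integral_map (continuous_flow_right hL t).aemeasurable hq.aestronglyMeasurable
  refine ⟨?_, ?_, ?_⟩
  · apply FiniteMeasure.toMeasure_injective
    have : flow a 0 = id := funext fun x => flow_zero hL x
    simp [this]
  · refine Continuous.continuousOn (continuous_iff_continuousAt.2 fun t => ?_)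
    refine FiniteMeasure.tendsto_iff_forall_integral_tendsto.2 fun q => ?_
    simp_rw [fun t => hmap t q q.continuous]
    refine tendsto_integral_filter_of_dominated_convergence (fun _ => ‖q‖)
      (Eventually.of_forall fun s =>
        (q.continuous.comp (continuous_flow_right hL s)).aestronglyMeasurable)
      (Eventually.of_forall fun s => Eventually.of_forall fun x => q.norm_coe_le_norm _)
      (integrable_const _) (Eventually.of_forall fun x => ?_)
    exact (q.continuous.comp (continuous_flow_left hL x)).tendsto t
  · intro ψ hψ hψs t ht
    set q : Vec d → ℝ := fun x => fderiv ℝ ψ x (a x) with hq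
    have hqc : Continuous q := (hψ.continuous_fderiv one_ne_zero).clm_apply hL.continuous
    obtain ⟨C, hC⟩ := hqc.bounded_above_of_compact_support (hasCompactSupport_fderiv_apply hψs a)
    obtain ⟨C', hC'⟩ := hψ.continuous.bounded_above_of_compact_support hψs
    have hk : Continuous fun p : ℝ × Vec d => q (flow a p.1 p.2) := hqc.comp (continuous_flow hL)
    rw [hmap t ψ hψ.continuous]
    simp_rw [fun s => hmap s q hqc]
    -- The weak formulation is the fundamental theorem of calculus along each trajectory, integrated
    -- over `f₀` with the order of integration exchanged.
    have hftc : ∀ x, ψ (flow a t x) = ψ x + ∫ s in (0 : ℝ)..t, q (flow a s x) := by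
      intro x
      have hd : ∀ s ∈ uIcc 0 t, HasDerivAt (fun s => ψ (flow a s x)) (q (flow a s x)) s :=
        fun s _ => (hψ.differentiable one_ne_zero (flow a s x)).hasFDerivAt.comp_hasDerivAt
          (f := fun s => flow a s x) s (hasDerivAt_flow hL x s)
      rw [intervalIntegral.integral_eq_sub_of_hasDerivAt hd
        ((hqc.comp (continuous_flow_left hL x)).intervalIntegrable _ _), flow_zero hL]
      ring
    have : IsFiniteMeasure (volume.restrict (uIoc 0 t)) := isFiniteMeasure_restrict_uIoc 0 t
    rw [intervalIntegral_integral_swap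
      (Integrable.of_bound hk.aestronglyMeasurable C (Eventually.of_forall fun p => hC _))]
    simp_rw [hftc]
    have hkc : Continuous fun x => ∫ s in (0 : ℝ)..t, q (flow a s x) :=
      intervalIntegral.continuous_parametric_intervalIntegral_of_continuous'
        (f := fun x s => q (flow a s x)) (hk.comp continuous_swap) 0 t
    refine integral_add (Integrable.of_bound hψ.continuous.aestronglyMeasurable C'
      (Eventually.of_forall hC'))
      (Integrable.of_bound hkc.aestronglyMeasurable (C * |t - 0|)
        (Eventually.of_forall fun x => ?_))
    exact intervalIntegral.norm_integral_le_of_norm_le_const fun s _ => hC _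

/-- A continuous compactly supported function, transported by the flow, is uniformly continuous in
time. -/
theorem eventually_norm_comp_flow_sub_le (hL : LipschitzWith K a) {q : Vec d → ℝ}
    (hq : Continuous q) (hqs : HasCompactSupport q) {ε : ℝ} (hε : 0 < ε) :
    ∃ δ > 0, ∀ r s : ℝ, |r - s| < δ → ∀ x, ‖q (flow a (-r) x) - q (flow a (-s) x)‖ ≤ ε := by
  have hc : Continuous fun p : ℝ × Vec d => flow a (-p.1) p.2 :=
    (continuous_flow hL).comp (by fun_prop : Continuous fun p : ℝ × Vec d => (-p.1, p.2))
  -- Outside this compact set `q ∘ Φ_r` vanishes for every `|r| ≤ 1`, which is why `δ` is capped at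
  -- `1` below.
  set k : Set (Vec d) := (fun p : ℝ × Vec d => flow a (-p.1) p.2) '' (Icc (-1) 1 ×ˢ tsupport q)
  have hk : IsCompact k := (isCompact_Icc.prod hqs).image hc
  have hout : ∀ r : ℝ, |r| ≤ 1 → ∀ y, y ∉ k → q (flow a r y) = 0 := by
    intro r hr y hy
    by_contra h
    exact hy ⟨(r, flow a r y), ⟨abs_le.1 hr, subset_tsupport _ h⟩, flow_neg_flow hL r y⟩
  obtain ⟨v, hv, hvk⟩ := hk.mem_uniformity_of_prod (f := fun r y => q (flow a r y))
    (s := univ) (q := 0) (hq.comp (continuous_flow hL)).continuousOn (mem_univ _)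
    (Metric.dist_mem_uniformity hε)
  rw [nhdsWithin_univ] at hv
  obtain ⟨δ, hδ, hδv⟩ := Metric.mem_nhds_iff.1 hv
  refine ⟨min δ 1, by positivity, fun r s hrs x => ?_⟩
  -- The group law reduces the claim to comparing `Φ_{s-r}` with the identity at the point `Φ_{-s}
  -- x`.
  have hr : flow a (-r) x = flow a (s - r) (flow a (-s) x) := by
    rw [← flow_add hL]; congr 1; ring
  have h1 : |s - r| < min δ 1 := by rwa [abs_sub_comm]
  have h2 := flow_zero hL (flow a (-s) x)
  rw [hr]
  by_cases hx : flow a (-s) x ∈ k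
  · have h3 := hvk (s - r) (hδv (by
      rw [mem_ball_zero_iff]; exact h1.trans_le (min_le_left _ _))) _ hx
    rw [h2] at h3
    rw [← dist_eq_norm]
    exact le_of_lt h3
  · rw [hout _ (h1.le.trans (min_le_right _ _)) _ hx, ← h2, hout 0 (by simp) _ hx]
    simpa using hε.le

/-- The test function `ψ ∘ Φ_{-r}` solves the adjoint equation, but depends on time, while the weak
formulation allows only fixed test functions. Near `s` it is split into its value at `s`, minus its
linear change `(r - s) q ∘ Φ_{-s}`, plus a remainder. The first two contributions have the same
derivative `p s` and cancel. -/
theorem hasDerivWithinAt_integral_comp_flow_neg (ha : ContDiff ℝ 1 a) (hL : LipschitzWith K a)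
    {f₀ : FiniteMeasure (Vec d)} {f : ℝ → FiniteMeasure (Vec d)}
    (hf : IsTransportSolution T a f₀ f) {ψ : Vec d → ℝ} (hψ : ContDiff ℝ 1 ψ)
    (hψs : HasCompactSupport ψ) {s : ℝ} (hs : s ∈ Icc 0 T) :
    HasDerivWithinAt (fun r => ∫ x, ψ (flow a (-r) x) ∂(f r : Measure (Vec d))) 0
      (Icc 0 T) s := by
  obtain ⟨-, hfc, hweak⟩ := hf
  set q : Vec d → ℝ := fun x => fderiv ℝ ψ x (a x) with hq
  have hqc : Continuous q := (hψ.continuous_fderiv one_ne_zero).clm_apply hL.continuous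
  have hqs : HasCompactSupport q := hasCompactSupport_fderiv_apply hψs a
  have hη : ∀ r, Continuous fun x => ψ (flow a (-r) x) := fun r =>
    hψ.continuous.comp (continuous_flow_right hL _)
  have hqη : Continuous fun x => q (flow a (-s) x) := hqc.comp (continuous_flow_right hL _)
  have hqηs : HasCompactSupport fun x => q (flow a (-s) x) := hqs.comp_flow hL _
  have hηint : ∀ r r', Integrable (fun x => ψ (flow a (-r) x)) (f r' : Measure (Vec d)) :=
    fun r r' => (hη r).integrable_of_hasCompactSupport (hψs.comp_flow hL _)
  have hqint : ∀ r', Integrable (fun x => q (flow a (-s) x)) (f r' : Measure (Vec d)) :=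
    fun r' => hqη.integrable_of_hasCompactSupport hqηs
  set p : ℝ → ℝ := fun r => ∫ x, q (flow a (-s) x) ∂(f r : Measure (Vec d)) with hp
  have hpc : ContinuousOn p (Icc 0 T) := continuousOn_integral_of_continuousOn hfc hqη hqηs
  -- the test function frozen at time `s`
  have hm : HasDerivWithinAt (fun r => ∫ x, ψ (flow a (-s) x) ∂(f r : Measure (Vec d))) (p s)
      (Icc 0 T) s := by
    have hη1 : ContDiff ℝ 1 fun x => ψ (flow a (-s) x) := hψ.comp
      ((contDiff_flow ha hL).comp (by fun_prop : ContDiff ℝ 1 fun x : Vec d => (-s, x)))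
    -- Invariance of `a` under the flow again: differentiating `ψ ∘ Φ_{-s}` along `a` gives `q ∘
    -- Φ_{-s}`.
    have hD : ∀ x, fderiv ℝ (fun x => ψ (flow a (-s) x)) x (a x) = q (flow a (-s) x) := by
      intro x
      have h := (hψ.differentiable one_ne_zero (flow a (-s) x)).hasFDerivAt.comp x
        (hasFDerivAt_flow ha hL (-s) x)
      change fderiv ℝ (ψ ∘ flow a (-s)) x (a x) = _
      rw [h.fderiv, ContinuousLinearMap.comp_apply, flowDeriv_apply_field ha hL]
    have hw := hweak _ hη1 (hψs.comp_flow hL _)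
    simp_rw [hD] at hw
    have hfact : Fact (s ∈ Icc 0 T) := ⟨hs⟩
    have hFTC : HasDerivWithinAt (fun r => ∫ σ in (0 : ℝ)..r, p σ) (p s) (Icc 0 T) s :=
      intervalIntegral.integral_hasDerivWithinAt_right
        ((hpc.mono (by rw [uIcc_of_le hs.1]; exact Icc_subset_Icc_right hs.2)).intervalIntegrable)
        (hpc.stronglyMeasurableAtFilter_nhdsWithin measurableSet_Icc s) (hpc s hs)
    exact (hFTC.const_add _).congr (fun r hr => hw r hr) (hw s hs)
  -- the linear change of the test function
  have hB : HasDerivWithinAt (fun r => (r - s) * p r) (p s) (Icc 0 T) s := by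
    rw [hasDerivWithinAt_iff_isLittleO]
    have h1 : (fun r => p r - p s) =o[𝓝[Icc 0 T] s] fun _ => (1 : ℝ) := by
      rw [Asymptotics.isLittleO_one_iff]
      simpa using (hpc s hs).sub_const (p s)
    refine ((Asymptotics.isBigO_refl (fun r => r - s) _).mul_isLittleO h1).congr
      (fun r => ?_) (fun r => by simp)
    simp only [sub_self, zero_mul, smul_eq_mul]
    ring
  -- the remainder
  have hA : HasDerivWithinAt (fun r => ∫ x, (ψ (flow a (-r) x) - ψ (flow a (-s) x) +
      (r - s) * q (flow a (-s) x)) ∂(f r : Measure (Vec d))) 0 (Icc 0 T) s := by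
    rw [hasDerivWithinAt_iff_isLittleO]
    simp only [sub_self, zero_mul, add_zero, integral_zero, sub_zero, smul_zero]
    have hmass : Tendsto (fun r => (f r : Measure (Vec d)).real univ) (𝓝[Icc 0 T] s)
        (𝓝 ((f s : Measure (Vec d)).real univ)) := by
      have := FiniteMeasure.tendsto_iff_forall_integral_tendsto.1 (hfc s hs)
        (BoundedContinuousFunction.const _ 1)
      simpa using this
    -- By narrow continuity the total mass of `f r` stays below `M` for `r` near `s`.
    set M : ℝ := (f s : Measure (Vec d)).real univ + 1 with hM
    have hM0 : 0 < M := by positivity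
    rw [Asymptotics.isLittleO_iff]
    intro ε hε
    obtain ⟨δ, hδ, hunif⟩ := eventually_norm_comp_flow_sub_le hL hqc hqs
      (ε := ε / M) (by positivity)
    have hnear : ∀ᶠ r in 𝓝[Icc 0 T] s, |r - s| < δ := by
      refine mem_nhdsWithin_of_mem_nhds ?_
      have : Continuous fun r : ℝ => |r - s| := by fun_prop
      exact this.continuousAt.eventually_lt continuousAt_const (by simpa using hδ)
    filter_upwards [hnear, hmass.eventually_lt_const (lt_add_one _)] with r hr hrM
    have hbound : ∀ x, ‖ψ (flow a (-r) x) - ψ (flow a (-s) x) + (r - s) * q (flow a (-s) x)‖ ≤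
        ε / M * ‖r - s‖ := by
      intro x
      -- Mean value inequality in time: this derivative is a difference of values of `q` along the
      -- flow, uniformly small in `x`.
      have hd : ∀ σ ∈ Metric.ball s δ, HasDerivWithinAt
          (fun σ => ψ (flow a (-σ) x) + σ * q (flow a (-s) x))
          (-q (flow a (-σ) x) + q (flow a (-s) x)) (Metric.ball s δ) σ := by
        intro σ _
        have h1 : HasDerivAt (fun σ => flow a (-σ) x) (-a (flow a (-σ) x)) σ := by
          simpa [Function.comp_def] using (hasDerivAt_flow hL x (-σ)).scomp σ (hasDerivAt_neg σ)
        have h2 := (hψ.differentiable one_ne_zero (flow a (-σ) x)).hasFDerivAt.comp_hasDerivAt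
          (f := fun σ => flow a (-σ) x) σ h1
        have h3 := h2.add ((hasDerivAt_id σ).mul_const (q (flow a (-s) x)))
        refine (h3.congr_deriv ?_).hasDerivWithinAt
        simp [hq]
      have h := (convex_ball s δ).norm_image_sub_le_of_norm_hasDerivWithin_le hd
        (C := ε / M) (fun σ hσ => by
          rw [neg_add_eq_sub, norm_sub_rev]
          exact hunif σ s (by simpa [Real.dist_eq] using hσ) x)
        (Metric.mem_ball_self hδ) (show r ∈ Metric.ball s δ by simpa [Real.dist_eq] using hr)
      refine le_of_eq_of_le ?_ h
      congr 1
      ring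
    refine (norm_integral_le_of_norm_le_const (Eventually.of_forall hbound)).trans ?_
    have hle : (f r : Measure (Vec d)).real univ / M ≤ 1 := by
      rw [div_le_one hM0]
      exact hrM.le
    calc ε / M * ‖r - s‖ * (f r : Measure (Vec d)).real univ
        = ε * ‖r - s‖ * ((f r : Measure (Vec d)).real univ / M) := by ring
      _ ≤ ε * ‖r - s‖ * 1 := by gcongr
      _ = ε * ‖r - s‖ := mul_one _
  refine ((hA.sub hB).add hm).congr_of_eventuallyEq_of_mem (Eventually.of_forall fun r => ?_) hs
    |>.congr_deriv (by ring)
  simp only [Pi.add_apply, Pi.sub_apply]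
  rw [integral_add (f := fun x => ψ (flow a (-r) x) - ψ (flow a (-s) x))
    ((hηint r r).sub (hηint s r)) ((hqint r).const_mul _),
    integral_sub (hηint r r) (hηint s r), integral_const_mul]
  simp only [hp]
  ring

/-- The push-forward of `f t` by `Φ_{-t}` has time-independent integrals against `C_c¹` functions,
hence equals `f₀`; pushing forward by `Φ_t` undoes it. -/
theorem IsTransportSolution.eq_map_flow (ha : ContDiff ℝ 1 a) (hL : LipschitzWith K a)
    (hT : 0 < T) {f₀ : FiniteMeasure (Vec d)} {f : ℝ → FiniteMeasure (Vec d)}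
    (hf : IsTransportSolution T a f₀ f) : ∀ t ∈ Icc 0 T, f t = f₀.map (flow a t) := by
  have hU : UniqueDiffOn ℝ (Icc 0 T) := uniqueDiffOn_Icc hT
  intro t ht
  have hback : (f t).map (flow a (-t)) = f₀ := by
    apply FiniteMeasure.toMeasure_injective
    refine measure_ext_of_forall_integral_contDiff fun ψ hψ hψs => ?_
    have hd := fun s (hs : s ∈ Icc 0 T) =>
      hasDerivWithinAt_integral_comp_flow_neg ha hL hf hψ hψs hs
    have h := constant_of_derivWithin_zero (fun s hs => (hd s hs).differentiableWithinAt)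
      (fun s hs => (hd s (Ico_subset_Icc_self hs)).derivWithin (hU s (Ico_subset_Icc_self hs)))
      t ht
    simp only [neg_zero, flow_zero hL, hf.1] at h
    rw [FiniteMeasure.toMeasure_map,
      integral_map (continuous_flow_right hL _).aemeasurable hψ.continuous.aestronglyMeasurable, h]
  apply FiniteMeasure.toMeasure_injective
  rw [← hback, FiniteMeasure.toMeasure_map, FiniteMeasure.toMeasure_map,
    Measure.map_map (continuous_flow_right hL _).measurable
      (continuous_flow_right hL _).measurable]
  have : flow a t ∘ flow a (-t) = id := funext fun x => flow_flow_neg hL t x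
  rw [this, Measure.map_id]

theorem pdeObjective_eq (ha : ContDiff ℝ 1 a) (hL : LipschitzWith K a) (hT : 0 < T)
    {ν : Vec d → ℝ} (hν : Continuous ν) (f₀ : FiniteMeasure (Vec d)) :
    pdeObjective T ν f₀ a = ∫ x, ν (flow a T x) ∂(f₀ : Measure (Vec d)) := by
  have h : IsTransportSolution T a f₀ (transportSolution T a f₀) :=
    Classical.epsilon_spec (p := IsTransportSolution T a f₀)
      ⟨_, isTransportSolution_map_flow hL T f₀⟩
  rw [pdeObjective, h.eq_map_flow ha hL hT T ⟨hT.le, le_rfl⟩, FiniteMeasure.toMeasure_map,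
    integral_map (continuous_flow_right hL _).aemeasurable hν.aestronglyMeasurable]

end Transport

/-! ### First variations of the objectives -/

section Variation

variable {d : ℕ} {a : Vec d → Vec d} {ν : Vec d → ℝ} {φ : Vec d → Vec d} {K : ℝ≥0} {T : ℝ}

/-- Carathéodory's form of the derivative: `G` is the difference quotient, so its continuity at `0`
suffices. -/
theorem hasDerivAt_of_eq_add_mul {F G : ℝ → ℝ} (hFG : ∀ ε, F ε = F 0 + ε * G ε)
    (hG : ContinuousAt G 0) : HasDerivAt F (G 0) 0 := by
  rw [hasDerivAt_iff_isLittleO]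
  have h1 : (fun ε => G ε - G 0) =o[𝓝 0] fun _ => (1 : ℝ) := by
    rw [Asymptotics.isLittleO_one_iff]
    simpa using hG.tendsto.sub_const (G 0)
  refine ((Asymptotics.isBigO_refl (fun ε : ℝ => ε) _).mul_isLittleO h1).congr
    (fun ε => ?_) (fun ε => by simp)
  simp only [smul_eq_mul, sub_zero]
  rw [hFG ε]
  ring

/-- The perturbation acts as a forcing of size at most `|ε| M` in Grönwall's inequality. The rate is
the Lipschitz constant of `a` alone, hence independent of `ε`. -/
theorem tendsto_flow_add_smul (ha : IsC1BddDeriv a) (hφ : IsCb1 φ) (t : ℝ) (y : Vec d) :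
    Tendsto (fun ε : ℝ => flow (a + ε • φ) t y) (𝓝 0) (𝓝 (flow a t y)) := by
  obtain ⟨K, hL⟩ := ha.exists_lipschitzWith
  obtain ⟨hφ1, M, hM⟩ := hφ
  refine tendsto_iff_norm_sub_tendsto_zero.2 ?_
  have hlim : Tendsto (fun ε : ℝ => gronwallBound 0 K (|ε| * M) |t|) (𝓝 0) (𝓝 0) := by
    have : Continuous fun ε : ℝ => gronwallBound 0 K (|ε| * M) |t| :=
      (gronwallBound_continuous_ε 0 K |t|).comp (by fun_prop)
    simpa [gronwallBound_ε0] using this.tendsto 0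
  refine squeeze_zero (fun _ => norm_nonneg _) (fun ε => ?_) hlim
  obtain ⟨K', hL'⟩ := (ha.add_smul hφ1 ε).exists_lipschitzWith
  refine norm_le_gronwallBound_abs (S := |t|)
    (fun s => (hasDerivAt_flow hL' y s).sub (hasDerivAt_flow hL y s))
    (by simp [flow_zero hL, flow_zero hL']) (fun s _ => ?_) le_rfl
  rw [Pi.add_apply, Pi.smul_apply, add_sub_right_comm]
  refine (norm_add_le _ _).trans (add_le_add (hL.norm_sub_le _ _) ?_)
  rw [norm_smul, Real.norm_eq_abs]
  exact mul_le_mul_of_nonneg_left (hM _) (abs_nonneg _)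

/-- Comparison of the terminal values along the flows of `a` and of a perturbation of `a`. -/
theorem terminal_value_flow_add_smul (ha : IsC1BddDeriv a) (hφ : IsC1BddDeriv φ)
    (hν : ContDiff ℝ 1 ν) (T ε : ℝ) (y : Vec d) :
    ν (flow (a + ε • φ) T y) = ν (flow a T y) + ε * ∫ t in (0 : ℝ)..T,
      sensitivity T a ν t (flow (a + ε • φ) t y) (φ (flow (a + ε • φ) t y)) := by
  obtain ⟨K, hL⟩ := ha.exists_lipschitzWith
  have hb := ha.add_smul hφ ε
  obtain ⟨K', hL'⟩ := hb.exists_lipschitzWith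
  set b := a + ε • φ with hbdef
  -- Along the perturbed flow the part of the velocity due to `a` cancels against `∂ₜg`, leaving
  -- only `ε φ·∇g`. The endpoints of this function of `t` are the two terminal values.
  have hd : ∀ t ∈ uIcc 0 T, HasDerivAt (fun t => ν (flow a (T - t) (flow b t y)))
      (ε * sensitivity T a ν t (flow b t y) (φ (flow b t y))) t := by
    intro t _
    set x := flow b t y with hx
    have hG := ((contDiff_backward (T := T) ha.1 hL hν).differentiable one_ne_zero
      (t, x)).hasFDerivAt
    set G := fderiv ℝ (fun p : ℝ × Vec d => ν (flow a (T - p.1) p.2)) (t, x)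
    have h1 : G (1, 0) = -(sensitivity T a ν t x (a x)) :=
      (hG.comp_hasDerivAt (f := fun s : ℝ => (s, x)) t
        ((hasDerivAt_id t).prodMk (hasDerivAt_const t x))).unique
        (hasDerivAt_backward_time ha.1 hL hν t x)
    have h2 : G.comp (ContinuousLinearMap.inr ℝ ℝ (Vec d)) = sensitivity T a ν t x :=
      (HasFDerivAt.comp (f := fun z : Vec d => (t, z)) x hG
        (hasFDerivAt_prodMk_right t x)).unique (hasFDerivAt_backward ha.1 hL hν t x)
    have h3 := hG.comp_hasDerivAt (f := fun s : ℝ => (s, flow b s y)) t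
      ((hasDerivAt_id t).prodMk (hasDerivAt_flow hL' y t))
    refine h3.congr_deriv ?_
    have h4 : ((1 : ℝ), b x) = (1, 0) + ContinuousLinearMap.inr ℝ ℝ (Vec d) (b x) := by simp
    rw [← hx, h4, map_add, h1, ← ContinuousLinearMap.comp_apply, h2, hbdef, Pi.add_apply,
      Pi.smul_apply, map_add, map_smul, smul_eq_mul]
    ring
  have hc : Continuous fun t => ε * sensitivity T a ν t (flow b t y) (φ (flow b t y)) := by
    have hfl := continuous_flow_left hL' y
    exact continuous_const.mul (((continuous_sensitivity ha.1 hL hν).comp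
      (continuous_id.prodMk hfl)).clm_apply (hφ.1.continuous.comp hfl))
  have h := intervalIntegral.integral_eq_sub_of_hasDerivAt hd (hc.intervalIntegrable _ _)
  rw [intervalIntegral.integral_const_mul, sub_self, flow_zero hL, flow_zero hL', sub_zero] at h
  rw [h]
  ring

/-- The integrated sensitivity `∫₀ᵀ ∇g(t, X(t)) · φ(X(t)) dt` along the trajectory of `y` under
the velocity field `b`. -/
noncomputable def integratedSensitivity (T : ℝ) (a : Vec d → Vec d) (ν : Vec d → ℝ)
    (b φ : Vec d → Vec d) (y : Vec d) : ℝ :=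
  ∫ t in (0 : ℝ)..T, sensitivity T a ν t (flow b t y) (φ (flow b t y))

theorem continuous_sensitivity_flow (ha : IsC1BddDeriv a) (hν : ContDiff ℝ 1 ν)
    {b : Vec d → Vec d} (hb : IsC1BddDeriv b) (hφ : Continuous φ) :
    Continuous fun p : ℝ × Vec d =>
      sensitivity T a ν p.1 (flow b p.1 p.2) (φ (flow b p.1 p.2)) := by
  obtain ⟨K, hL⟩ := ha.exists_lipschitzWith
  obtain ⟨K', hL'⟩ := hb.exists_lipschitzWith
  have hfl := continuous_flow hL'
  exact ((continuous_sensitivity ha.1 hL hν).comp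
    (continuous_fst.prodMk hfl)).clm_apply (hφ.comp hfl)

theorem continuous_integratedSensitivity (ha : IsC1BddDeriv a) (hν : ContDiff ℝ 1 ν)
    {b : Vec d → Vec d} (hb : IsC1BddDeriv b) (hφ : Continuous φ) :
    Continuous (integratedSensitivity T a ν b φ) :=
  intervalIntegral.continuous_parametric_intervalIntegral_of_continuous'
    (f := fun y t => sensitivity T a ν t (flow b t y) (φ (flow b t y)))
    ((continuous_sensitivity_flow ha hν hb hφ).comp continuous_swap) 0 T

theorem exists_abs_sensitivity_apply_le (ha : IsC1BddDeriv a) (hν : IsC1BddDeriv ν) (T : ℝ) :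
    ∃ C, 0 ≤ C ∧ ∀ (φ : Vec d → Vec d) (M : ℝ), (∀ x, ‖φ x‖ ≤ M) →
      ∀ t ∈ uIoc 0 T, 0 ≤ T → ∀ x, ‖sensitivity T a ν t x (φ x)‖ ≤ C * M := by
  obtain ⟨K, hL⟩ := ha.exists_lipschitzWith
  obtain ⟨C, hC0, hC⟩ := exists_norm_sensitivity_le (T := T) ha.1 hL hν
  refine ⟨C, hC0, fun φ M hM t ht hT x => ?_⟩
  rw [uIoc_of_le hT] at ht
  refine (ContinuousLinearMap.le_opNorm _ _).trans ?_
  exact mul_le_mul (hC t ⟨ht.1.le, ht.2⟩ x) (hM x) (norm_nonneg _) hC0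

/-- The constant does not depend on `b`: this dominates the integrands as `ε` varies, and it bounds
the first variation by the sup norm of `φ` alone. -/
theorem exists_abs_integratedSensitivity_le (ha : IsC1BddDeriv a) (hν : IsC1BddDeriv ν)
    (hT : 0 < T) :
    ∃ C, 0 ≤ C ∧ ∀ (b φ : Vec d → Vec d) (M : ℝ), (∀ x, ‖φ x‖ ≤ M) →
      ∀ y, ‖integratedSensitivity T a ν b φ y‖ ≤ C * M := by
  obtain ⟨C, hC0, hC⟩ := exists_abs_sensitivity_apply_le ha hν T
  refine ⟨C * T, by positivity, fun b φ M hM y => ?_⟩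
  have := intervalIntegral.norm_integral_le_of_norm_le_const
    (f := fun t => sensitivity T a ν t (flow b t y) (φ (flow b t y))) (a := 0) (b := T)
    (fun t ht => hC φ M hM t ht hT.le (flow b t y))
  rw [sub_zero, abs_of_pos hT] at this
  refine this.trans (le_of_eq (by ring))

theorem integrable_integratedSensitivity (ha : IsC1BddDeriv a) (hν : IsC1BddDeriv ν)
    (hT : 0 < T) (hφ : IsCb1 φ) {b : Vec d → Vec d} (hb : IsC1BddDeriv b)
    (μ : Measure (Vec d)) [IsFiniteMeasure μ] :
    Integrable (integratedSensitivity T a ν b φ) μ := by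
  obtain ⟨C, -, hC⟩ := exists_abs_integratedSensitivity_le ha hν hT
  obtain ⟨hφ1, M, hM⟩ := hφ
  exact Integrable.of_bound
    (continuous_integratedSensitivity ha hν.1 hb hφ1.1.continuous).aestronglyMeasurable _
    (Eventually.of_forall (hC b φ M hM))

/-- Dominated convergence twice, over initial points and over time, from pointwise convergence of
the perturbed trajectories. -/
theorem tendsto_integral_integratedSensitivity (ha : IsC1BddDeriv a) (hν : IsC1BddDeriv ν)
    (hT : 0 < T) (hφ : IsCb1 φ) (μ : Measure (Vec d)) [IsFiniteMeasure μ] :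
    Tendsto (fun ε : ℝ => ∫ y, integratedSensitivity T a ν (a + ε • φ) φ y ∂μ) (𝓝 0)
      (𝓝 (∫ y, integratedSensitivity T a ν a φ y ∂μ)) := by
  obtain ⟨C, -, hC⟩ := exists_abs_integratedSensitivity_le ha hν hT
  obtain ⟨C', -, hC'⟩ := exists_abs_sensitivity_apply_le ha hν T
  have hlim := tendsto_flow_add_smul ha hφ
  obtain ⟨hφ1, M, hM⟩ := hφ
  obtain ⟨K, hL⟩ := ha.exists_lipschitzWith
  have hc := fun ε : ℝ => ha.add_smul hφ1 ε
  refine tendsto_integral_filter_of_dominated_convergence (fun _ => C * M)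
    (Eventually.of_forall fun ε =>
      (continuous_integratedSensitivity ha hν.1 (hc ε) hφ1.1.continuous).aestronglyMeasurable)
    (Eventually.of_forall fun ε => Eventually.of_forall (hC _ φ M hM))
    (integrable_const _) (Eventually.of_forall fun y => ?_)
  refine intervalIntegral.tendsto_integral_filter_of_dominated_convergence (fun _ => C' * M)
    (Eventually.of_forall fun ε =>
      ((continuous_sensitivity_flow ha hν.1 (hc ε) hφ1.1.continuous).comp
        (by fun_prop : Continuous fun t : ℝ => (t, y))).aestronglyMeasurable)
    (Eventually.of_forall fun ε => Eventually.of_forall fun t ht => hC' φ M hM t ht hT.le _)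
    intervalIntegrable_const (Eventually.of_forall fun t _ => ?_)
  have hk : Continuous fun x => sensitivity T a ν t x (φ x) :=
    ((continuous_sensitivity ha.1 hL hν.1).comp
      (by fun_prop : Continuous fun x : Vec d => (t, x))).clm_apply hφ1.1.continuous
  exact (hk.tendsto _).comp (hlim t y)

theorem exists_hasFirstVariation_pdeObjective (ha : IsC1BddDeriv a) (hν : IsCb1 ν) (hT : 0 < T)
    (f₀ : FiniteMeasure (Vec d)) :
    ∃ L : testFields d →ₗ[ℝ] ℝ,
      (∀ φ : testFields d, L φ =
        ∫ y, integratedSensitivity T a ν a (φ : Vec d → Vec d) y ∂(f₀ : Measure (Vec d))) ∧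
      HasFirstVariation (pdeObjective T ν f₀) a L := by
  have hint := fun φ : testFields d =>
    integrable_integratedSensitivity ha hν.1 hT φ.2 ha (f₀ : Measure (Vec d))
  have hii : ∀ (φ : testFields d) (y : Vec d), IntervalIntegrable (fun t =>
      sensitivity T a ν t (flow a t y) ((φ : Vec d → Vec d) (flow a t y))) volume 0 T :=
    fun φ y => ((continuous_sensitivity_flow ha hν.1.1 ha φ.2.1.1.continuous).comp
      (by fun_prop : Continuous fun t : ℝ => (t, y))).intervalIntegrable _ _
  let L : testFields d →ₗ[ℝ] ℝ :=
    { toFun := fun φ =>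
        ∫ y, integratedSensitivity T a ν a (φ : Vec d → Vec d) y ∂(f₀ : Measure (Vec d))
      map_add' := fun φ ψ => by
        rw [← integral_add (hint φ) (hint ψ)]
        refine integral_congr_ae (Eventually.of_forall fun y => ?_)
        simp only [integratedSensitivity]
        rw [← intervalIntegral.integral_add (hii φ y) (hii ψ y)]
        refine intervalIntegral.integral_congr fun t _ => ?_
        simp
      map_smul' := fun c φ => by
        rw [RingHom.id_apply, smul_eq_mul, ← integral_const_mul]
        refine integral_congr_ae (Eventually.of_forall fun y => ?_)
        simp only [integratedSensitivity]
        rw [← intervalIntegral.integral_const_mul]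
        refine intervalIntegral.integral_congr fun t _ => ?_
        simp }
  refine ⟨L, fun φ => rfl, fun φ => ?_, ?_⟩
  · obtain ⟨Mν, hMν⟩ := hν.2
    have hobj : ∀ ε : ℝ, pdeObjective T ν f₀ (a + ε • (φ : Vec d → Vec d)) =
        ∫ y, ν (flow (a + ε • (φ : Vec d → Vec d)) T y) ∂(f₀ : Measure (Vec d)) := fun ε => by
      have hb := ha.add_smul φ.2.1 ε
      obtain ⟨K, hL⟩ := hb.exists_lipschitzWith
      exact pdeObjective_eq hb.1 hL hT hν.1.1.continuous f₀
    have ha0 : a + (0 : ℝ) • (φ : Vec d → Vec d) = a := by simp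
    have hG0 : L φ = (fun ε : ℝ => ∫ y, integratedSensitivity T a ν
        (a + ε • (φ : Vec d → Vec d)) (φ : Vec d → Vec d) y ∂(f₀ : Measure (Vec d))) 0 := by
      simp only [ha0]
      rfl
    rw [hG0]
    refine hasDerivAt_of_eq_add_mul
      (F := fun ε : ℝ => pdeObjective T ν f₀ (a + ε • (φ : Vec d → Vec d)))
      (G := fun ε : ℝ => ∫ y, integratedSensitivity T a ν
        (a + ε • (φ : Vec d → Vec d)) (φ : Vec d → Vec d) y ∂(f₀ : Measure (Vec d)))
      (fun ε => ?_) ?_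
    · obtain ⟨K, hL⟩ := ha.exists_lipschitzWith
      simp only [hobj]
      rw [ha0, ← integral_const_mul, ← integral_add]
      · exact integral_congr_ae (Eventually.of_forall fun y =>
          terminal_value_flow_add_smul ha φ.2.1 hν.1.1 T ε y)
      · exact Integrable.of_bound
          (hν.1.1.continuous.comp (continuous_flow_right hL T)).aestronglyMeasurable Mν
          (Eventually.of_forall fun y => hMν _)
      · exact (integrable_integratedSensitivity ha hν.1 hT φ.2
          (ha.add_smul φ.2.1 ε) _).const_mul ε
    · have h := tendsto_integral_integratedSensitivity ha hν.1 hT φ.2 (f₀ : Measure (Vec d))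
      simpa [ContinuousAt] using h
  · obtain ⟨C, hC0, hC⟩ := exists_abs_integratedSensitivity_le ha hν.1 hT
    refine ⟨C * (f₀ : Measure (Vec d)).real univ, fun φ M hM => ?_⟩
    have h := norm_integral_le_of_norm_le_const (μ := (f₀ : Measure (Vec d)))
      (Eventually.of_forall (hC a (φ : Vec d → Vec d) M fun x => (hM x).1))
    exact h.trans (le_of_eq (by ring))

theorem pdeObjective_diracMass (ha : IsC1BddDeriv a) (hν : Continuous ν) (hT : 0 < T)
    (y : Vec d) : pdeObjective T ν (diracMass y) a = particleObjective T ν y a := by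
  obtain ⟨K, hL⟩ := ha.exists_lipschitzWith
  rw [pdeObjective_eq ha.1 hL hT hν, particleObjective_eq hL hT.le]
  exact integral_dirac _ _

/-- Special case of the PDE objective: with Dirac datum the two objectives agree at every `a + εφ`,
so their derivatives in `ε` agree as well. -/
theorem exists_hasFirstVariation_particleObjective (ha : IsC1BddDeriv a) (hν : IsCb1 ν)
    (hT : 0 < T) (y : Vec d) :
    ∃ L : testFields d →ₗ[ℝ] ℝ,
      (∀ φ : testFields d, L φ = integratedSensitivity T a ν a (φ : Vec d → Vec d) y) ∧
      HasFirstVariation (particleObjective T ν y) a L := by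
  obtain ⟨L, hL, hd, hb⟩ := exists_hasFirstVariation_pdeObjective ha hν hT (diracMass y)
  refine ⟨L, fun φ => ?_, fun φ => ?_, hb⟩
  · rw [hL]
    exact integral_dirac _ _
  · refine (hd φ).congr_of_eventuallyEq (Eventually.of_forall fun ε => ?_)
    exact (pdeObjective_diracMass (ha.add_smul φ.2.1 ε) hν.1.1.continuous hT y).symm

theorem exists_hasFirstVariation_nParticleObjective (ha : IsC1BddDeriv a) (hν : IsCb1 ν)
    (hT : 0 < T) {N : ℕ} (x₀ : Fin N → Vec d) :
    ∃ L : testFields d →ₗ[ℝ] ℝ,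
      (∀ φ : testFields d, L φ = (N : ℝ)⁻¹ *
        ∑ i, integratedSensitivity T a ν a (φ : Vec d → Vec d) (x₀ i)) ∧
      HasFirstVariation (nParticleObjective T ν x₀) a L := by
  choose L hL hd C hC using fun i => exists_hasFirstVariation_particleObjective ha hν hT (x₀ i)
  have happ : ∀ φ, ((N : ℝ)⁻¹ • ∑ i, L i) φ = (N : ℝ)⁻¹ * ∑ i, L i φ := fun φ => by
    simp [LinearMap.sum_apply]
  refine ⟨(N : ℝ)⁻¹ • ∑ i, L i, fun φ => by simp_rw [happ, hL], fun φ => ?_,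
    (N : ℝ)⁻¹ * ∑ i, C i, fun φ M hM => ?_⟩
  · rw [happ]
    exact (HasDerivAt.fun_sum fun i _ => hd i φ).const_mul _
  · rw [happ, abs_mul, abs_of_nonneg (by positivity : (0 : ℝ) ≤ (N : ℝ)⁻¹), mul_assoc,
      Finset.sum_mul]
    gcongr
    exact (Finset.abs_sum_le_sum_abs _ _).trans (Finset.sum_le_sum fun i _ => hC i φ M hM)

/-- Fubini exchanges time and initial point; the inner integral over initial points is then one
against the push-forward by `Φ_t`. -/
theorem integral_integratedSensitivity_eq (ha : IsC1BddDeriv a) (hν : IsCb1 ν) (hT : 0 < T)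
    (hφ : IsCb1 φ) (f₀ : FiniteMeasure (Vec d)) :
    ∫ y, integratedSensitivity T a ν a φ y ∂(f₀ : Measure (Vec d)) =
      ∫ t in (0 : ℝ)..T, ∫ x, sensitivity T a ν t x (φ x)
        ∂((f₀.map (flow a t) : FiniteMeasure (Vec d)) : Measure (Vec d)) := by
  obtain ⟨K, hL⟩ := ha.exists_lipschitzWith
  obtain ⟨C, -, hC⟩ := exists_abs_sensitivity_apply_le ha hν.1 T
  obtain ⟨hφ1, M, hM⟩ := hφ
  have hk : ∀ t, Continuous fun x => sensitivity T a ν t x (φ x) := fun t =>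
    ((continuous_sensitivity ha.1 hL hν.1.1).comp
      (by fun_prop : Continuous fun x : Vec d => (t, x))).clm_apply hφ1.1.continuous
  simp_rw [FiniteMeasure.toMeasure_map]
  have hmap : ∀ t, ∫ x, sensitivity T a ν t x (φ x)
      ∂(Measure.map (flow a t) (f₀ : Measure (Vec d))) =
      ∫ y, sensitivity T a ν t (flow a t y) (φ (flow a t y)) ∂(f₀ : Measure (Vec d)) := fun t =>
    integral_map (continuous_flow_right hL t).aemeasurable (hk t).aestronglyMeasurable
  simp_rw [hmap]
  have : IsFiniteMeasure (volume.restrict (uIoc 0 T)) := isFiniteMeasure_restrict_uIoc 0 T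
  rw [intervalIntegral_integral_swap]
  · rfl
  · refine Integrable.of_bound (C := C * M)
      (continuous_sensitivity_flow ha hν.1.1 ha hφ1.1.continuous).aestronglyMeasurable ?_
    -- The uniform bound is available only for times in `(0, T]`, hence almost everywhere for the
    -- product measure.
    have h1 : ∀ᵐ p ∂((volume.restrict (uIoc 0 T)).prod (f₀ : Measure (Vec d))),
        p.1 ∈ uIoc 0 T :=
      Measure.quasiMeasurePreserving_fst.ae (ae_restrict_mem measurableSet_uIoc)
    filter_upwards [h1] with p hp
    exact hC φ M hM p.1 hp hT.le _

end Variation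

end TransportVariation

/-! ### Conclusion -/

theorem mainTheorem1 {d : ℕ} (T : ℝ) (hT : 0 < T)
    (ν : Vec d → ℝ) (hν : IsCb1 ν)
    (a : Vec d → Vec d)
    (ha : IsC1BddDeriv a) :
    -- the forward problems are well posed on `[0, T]`
    (∀ X₀ : Vec d,
      (∃ X, IsCharacteristic T a X₀ X) ∧
      ∀ X X', IsCharacteristic T a X₀ X →
        IsCharacteristic T a X₀ X' → ∀ t ∈ Set.Icc 0 T, X t = X' t) ∧
    (∀ f₀ : FiniteMeasure (Vec d),
      (∃ f, IsTransportSolution T a f₀ f) ∧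
      ∀ f f', IsTransportSolution T a f₀ f →
        IsTransportSolution T a f₀ f' → ∀ t ∈ Set.Icc 0 T, f t = f' t) ∧
    -- the first variations exist
    (∀ X₀ : Vec d, FirstVariationExists
      (particleObjective T ν X₀) a) ∧
    (∀ f₀ : FiniteMeasure (Vec d), FirstVariationExists
      (pdeObjective T ν f₀) a) ∧
    -- (a) Dirac initial data
    (∀ X₀ : Vec d,
      firstVariation
          (pdeObjective T ν (diracMass X₀)) a =
        firstVariation (particleObjective T ν X₀) a) ∧
    -- (b) general initial data
    (∀ (f₀ : FiniteMeasure (Vec d)) (φ : testFields d),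
      Integrable (fun y => firstVariation
        (particleObjective T ν y) a φ)
        (f₀ : Measure (Vec d)) ∧
      firstVariation (pdeObjective T ν f₀) a φ =
        ∫ y, firstVariation
          (particleObjective T ν y) a φ
          ∂(f₀ : Measure (Vec d))) ∧
    -- the gradient of the `N`-particle objective is unbiased for every `N ≥ 1`
    (∀ (f₀ : FiniteMeasure (Vec d)) (N : ℕ), 0 < N →
      (∀ x₀ : Fin N → Vec d, FirstVariationExists
        (nParticleObjective T ν x₀) a) ∧
      ∀ (Ω : Type*) [MeasurableSpace Ω] (P : Measure Ω) [IsProbabilityMeasure P]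
        (X₀ : Fin N → Ω → Vec d),
        (∀ i, ProbabilityTheory.HasLaw (X₀ i) (f₀ : Measure (Vec d)) P) →
        ∀ φ : testFields d,
          Integrable (fun ω => firstVariation
            (nParticleObjective T ν (fun i => X₀ i ω)) a φ) P ∧
          ∫ ω, firstVariation
              (nParticleObjective T ν (fun i => X₀ i ω)) a φ ∂P =
            firstVariation (pdeObjective T ν f₀) a φ) ∧
    -- the adjoint representations of the two first variations, and the relation between
    -- the two adjoint states along characteristics
    (∃ g, IsPDEAdjoint T a ν g) ∧
    (∀ g, IsPDEAdjoint T a ν g →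
      ∀ f₀ f, IsTransportSolution T a f₀ f →
      ∀ φ : testFields d,
        firstVariation (pdeObjective T ν f₀) a φ =
          ∫ t in (0 : ℝ)..T, ∫ x, inner ℝ (gradient (g t) x)
            ((φ : Vec d → Vec d) x)
            ∂(f t : Measure (Vec d))) ∧
    (∀ X₀ X, IsCharacteristic T a X₀ X →
      (∃ Y, IsParticleAdjoint T a ν X Y) ∧
      ∀ Y, IsParticleAdjoint T a ν X Y →
        (∀ φ : testFields d,
          firstVariation (particleObjective T ν X₀) a φ =
            ∫ t in (0 : ℝ)..T, inner ℝ (Y t)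
              ((φ : Vec d → Vec d) (X t))) ∧
        ∀ g, IsPDEAdjoint T a ν g →
          ∀ t ∈ Set.Icc 0 T, gradient (g t) (X t) = Y t) := by
  obtain ⟨K, hL⟩ := ha.exists_lipschitzWith
  -- The abstractly chosen first variations are identified with explicit integrals; after that, (a),
  -- (b) and unbiasedness are statements about one function of `y`.
  have hpde : ∀ (f₀ : FiniteMeasure (Vec d)) (φ : testFields d),
      firstVariation (pdeObjective T ν f₀) a φ =
        ∫ y, integratedSensitivity T a ν a (φ : Vec d → Vec d) y ∂(f₀ : Measure (Vec d)) := by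
    intro f₀ φ
    obtain ⟨L, hLφ, hFV⟩ := exists_hasFirstVariation_pdeObjective ha hν hT f₀
    rw [hFV.firstVariation_eq, hLφ]
  have hpar : ∀ (y : Vec d) (φ : testFields d), firstVariation (particleObjective T ν y) a φ =
      integratedSensitivity T a ν a (φ : Vec d → Vec d) y := by
    intro y φ
    obtain ⟨L, hLφ, hFV⟩ := exists_hasFirstVariation_particleObjective ha hν hT y
    rw [hFV.firstVariation_eq, hLφ]
  have hnpar : ∀ {N : ℕ} (x₀ : Fin N → Vec d) (φ : testFields d),
      firstVariation (nParticleObjective T ν x₀) a φ =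
        (N : ℝ)⁻¹ * ∑ i, integratedSensitivity T a ν a (φ : Vec d → Vec d) (x₀ i) := by
    intro N x₀ φ
    obtain ⟨L, hLφ, hFV⟩ := exists_hasFirstVariation_nParticleObjective ha hν hT x₀
    rw [hFV.firstVariation_eq, hLφ]
  have hint := fun (f₀ : FiniteMeasure (Vec d)) (φ : testFields d) =>
    integrable_integratedSensitivity ha hν.1 hT φ.2 ha (f₀ : Measure (Vec d))
  refine ⟨fun X₀ => ⟨⟨_, isCharacteristic_flow hL T X₀⟩, fun X X' hX hX' t ht => ?_⟩,
    fun f₀ => ⟨⟨_, isTransportSolution_map_flow hL T f₀⟩, fun f f' hf hf' t ht => ?_⟩,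
    fun X₀ => ?_, fun f₀ => ?_, fun X₀ => ?_, fun f₀ φ => ?_, fun f₀ N hN => ⟨fun x₀ => ?_, ?_⟩,
    ⟨_, isPDEAdjoint_backward ha.1 hL hν.1.1⟩, fun g hg f₀ f hf φ => ?_,
    fun X₀ X hX => ⟨exists_isParticleAdjoint ha.1 hL ν hX, fun Y hY => ⟨fun φ => ?_,
      fun g hg t ht => ?_⟩⟩⟩
  · rw [hX.eq_flow hL t ht, hX'.eq_flow hL t ht]
  · rw [hf.eq_map_flow ha.1 hL hT t ht, hf'.eq_map_flow ha.1 hL hT t ht]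
  · obtain ⟨L, -, h⟩ := exists_hasFirstVariation_particleObjective ha hν hT X₀
    exact ⟨L, h⟩
  · obtain ⟨L, -, h⟩ := exists_hasFirstVariation_pdeObjective ha hν hT f₀
    exact ⟨L, h⟩
  · ext φ
    rw [hpde, hpar]
    exact integral_dirac _ _
  · simp_rw [hpar, hpde]
    exact ⟨hint f₀ φ, trivial⟩
  · obtain ⟨L, -, h⟩ := exists_hasFirstVariation_nParticleObjective ha hν hT x₀
    exact ⟨L, h⟩
  · intro Ω _ P _ X₀ hlaw φ
    have hX : ∀ i, Integrable
        (fun ω => integratedSensitivity T a ν a (φ : Vec d → Vec d) (X₀ i ω)) P := fun i => by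
      have h := hint f₀ φ
      rw [← (hlaw i).map_eq] at h
      exact h.comp_aemeasurable (hlaw i).aemeasurable
    have hE : ∀ i, ∫ ω, integratedSensitivity T a ν a (φ : Vec d → Vec d) (X₀ i ω) ∂P =
        ∫ y, integratedSensitivity T a ν a (φ : Vec d → Vec d) y ∂(f₀ : Measure (Vec d)) :=
      fun i => (hlaw i).integral_comp (hint f₀ φ).aestronglyMeasurable
    simp_rw [hnpar, hpde]
    refine ⟨(integrable_finsetSum _ fun i _ => hX i).const_mul _, ?_⟩
    -- Only linearity of the expectation enters, so the joint law of the points plays no role; `N ≠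
    -- 0` serves to cancel `N⁻¹ * N`.
    rw [integral_const_mul, integral_finsetSum _ fun i _ => hX i]
    simp_rw [hE]
    rw [Finset.sum_const, Finset.card_univ, Fintype.card_fin, nsmul_eq_mul,
      inv_mul_cancel_left₀ (Nat.cast_ne_zero.2 hN.ne')]
  · rw [hpde, integral_integratedSensitivity_eq ha hν hT φ.2]
    refine intervalIntegral.integral_congr fun t ht => ?_
    rw [Set.uIcc_of_le hT.le] at ht
    simp only [hf.eq_map_flow ha.1 hL hT t ht, hg.inner_gradient ha.1 hL hν.1.1 hT ht]
  · rw [hpar]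
    refine intervalIntegral.integral_congr fun t ht => ?_
    rw [Set.uIcc_of_le hT.le] at ht
    simp only [hY.inner_eq ha.1 hL hT hX ht, hX.eq_flow hL t ht]
  -- Both vectors represent the same functional, the sensitivity at `(t, X t)`.
  · refine ext_inner_right ℝ fun v => ?_
    rw [hg.inner_gradient ha.1 hL hν.1.1 hT ht, hY.inner_eq ha.1 hL hT hX ht]
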